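/- Let $\mathbb{R}^{4,4}$ be $\mathbb{R}^8$ with the scalar product of signature $(4,4)$ given, in block form with blocks of sizes $2,4,2$, by $$Q=\begin{pmatrix}0&0&I_2\\0&\tilde I&0\\I_2&0&0\end{pmatrix},\qquad \tilde I=\begin{pmatrix}I_2&0\\0&-I_2\end{pmatrix},$$ and let $\mathrm{Iso}(\mathbb{R}^{4,4})$ be the group of affine transformations of $\mathbb{R}^8$ whose linear part preserves this scalar product. Let $\Gamma_{4,4}$ be the group generated by the affine transformations $\gamma_i(x)=(I+A_i)x+v_i$, $i=1,2$, where $$A_i=\begin{pmatrix}0&-B_i^\top\tilde I&0\\0&0&B_i\\0&0&0\end{pmatrix},\qquad v_i=\begin{pmatrix}0\\w_i\\0\end{pmatrix},$$ $$B_1=\begin{pmatrix}-1&0\\0&-1\\0&-1\\-1&0\end{pmatrix},\quad w_1=\begin{pmatrix}1\\0\\0\\1\end{pmatrix},\quad B_2=\begin{pmatrix}0&-1\\1&0\\-1&0\\0&1\end{pmatrix},\quad w_2=\begin{pmatrix}0\\-1\\1\\0\end{pmatrix}.$$ Then $\Gamma_{4,4}\le\mathrm{Iso}(\mathbb{R}^{4,4})$,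 the group $\Gamma_{4,4}$ is isomorphic to the discrete Heisenberg group of integral unitriangular $3\times 3$ matrices, and the orbit of $0$ under the centralizer $G$ of $\Gamma_{4,4}$ in $\mathrm{Iso}(\mathbb{R}^{4,4})$ is open in $\mathbb{R}^8$. Moreover, let $U$ be any open orbit of $G$ in $\mathbb{R}^8$. Then $\Gamma_{4,4}$ preserves $U$, and acts freely and properly discontinuously on $U$ (for every compact $K\subseteq U$ only finitely many $\gamma\in\Gamma_{4,4}$ satisfy $\gamma K\cap K\ne\emptyset$). The group of linear parts of the elements of $\Gamma_{4,4}$ is non-abelian. The quotient $M=U/\Gamma_{4,4}$ is a connected second countable Hausdorff space, and it carries the structure of a smooth $8$-manifold with a pseudo-Riemannian metric such that the projection $U\to M$ is a local diffeomorphism that pulls the metric of $M$ back to the scalar product of $\mathbb{R}^{4,4}$. With this metric, $M$ has signature $(4,4)$, is flat (its curvature tensor vanishes), is homogeneous (its isometry group acts transitively), is not geodesically complete, and at every point of $M$ the linear holonomy group of its Levi-Civita connection is non-abelian. -/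

import Mathlib

open scoped Manifold ContDiff Matrix

/-! ### Pseudo-Riemannian manifolds modelled on `ℝⁿ` -/

/-- The tangent space at `x` of a manifold `M` with charts in `ℝⁿ`. -/
abbrev Tan (n : ℕ) {M : Type*} [TopologicalSpace M] [ChartedSpace (Fin n → ℝ) M] (x : M) : Type :=
  TangentSpace 𝓘(ℝ, Fin n → ℝ) x

/-- The components `g_{ij}(y) = g(∂_i, ∂_j)` in the chart `e` of a field `g` of bilinear forms on
the tangent spaces; meaningful for `y ∈ e.target`. -/
noncomputable def metricComponents {n : ℕ} {M : Type*} [TopologicalSpace M]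
    [ChartedSpace (Fin n → ℝ) M] (g : ∀ x : M, Tan n x →ₗ[ℝ] Tan n x →ₗ[ℝ] ℝ)
    (e : OpenPartialHomeomorph M (Fin n → ℝ)) (y : Fin n → ℝ) : Matrix (Fin n) (Fin n) ℝ :=
  Matrix.of fun i j =>
    g (e.symm y)
      (mfderiv 𝓘(ℝ, Fin n → ℝ) 𝓘(ℝ, Fin n → ℝ) e.symm y (Pi.single i (1 : ℝ) : Fin n → ℝ))
      (mfderiv 𝓘(ℝ, Fin n → ℝ) 𝓘(ℝ, Fin n → ℝ) e.symm y (Pi.single j (1 : ℝ) : Fin n → ℝ))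

/-- A pseudo-Riemannian metric: a smooth field of nondegenerate symmetric bilinear forms on the
tangent spaces, smoothness meaning that its components in the charts of the atlas are smooth. -/
structure PseudoRiemannianMetric (n : ℕ) (M : Type*) [TopologicalSpace M]
    [ChartedSpace (Fin n → ℝ) M] [IsManifold 𝓘(ℝ, Fin n → ℝ) ∞ M] where
  val : ∀ x : M, Tan n x →ₗ[ℝ] Tan n x →ₗ[ℝ] ℝ
  symm : ∀ (x : M) (u v : Tan n x), val x u v = val x v u
  nondegenerate : ∀ (x : M) (u : Tan n x), (∀ v : Tan n x, val x u v = 0) → u = 0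
  smooth : ∀ e ∈ atlas (Fin n → ℝ) M, ∀ i j : Fin n,
    ContDiffOn ℝ ∞ (fun y => metricComponents val e y i j) e.target

namespace PseudoRiemannianMetric

variable {n : ℕ} {M : Type*} [TopologicalSpace M] [ChartedSpace (Fin n → ℝ) M]
  [IsManifold 𝓘(ℝ, Fin n → ℝ) ∞ M] (g : PseudoRiemannianMetric n M)

/-- The metric has signature `(r, s)`: every tangent space has an orthonormal basis of `r` vectors
of square `1` and `s` vectors of square `-1`. -/
def HasSignature (r s : ℕ) : Prop :=
  ∀ x : M, ∃ b : Module.Basis (Fin r ⊕ Fin s) ℝ (Tan n x),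
    (∀ i j, i ≠ j → g.val x (b i) (b j) = 0) ∧
    (∀ i : Fin r, g.val x (b (Sum.inl i)) (b (Sum.inl i)) = 1) ∧
    (∀ j : Fin s, g.val x (b (Sum.inr j)) (b (Sum.inr j)) = -1)

/-- The partial derivative `∂_i f (y)` of a function on `ℝⁿ`. -/
noncomputable def partialDeriv {n : ℕ} (i : Fin n) (f : (Fin n → ℝ) → ℝ) (y : Fin n → ℝ) : ℝ :=
  fderiv ℝ f y (Pi.single i 1)

/-- The Christoffel symbols of the Levi-Civita connection in the chart `e`:
`Γ^k_{ij} = ½ ∑_l g^{kl} (∂_i g_{jl} + ∂_j g_{il} - ∂_l g_{ij})`. -/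
noncomputable def christoffel (e : OpenPartialHomeomorph M (Fin n → ℝ)) (k i j : Fin n)
    (y : Fin n → ℝ) : ℝ :=
  (1 / 2 : ℝ) * ∑ l, (metricComponents g.val e y)⁻¹ k l *
    (partialDeriv i (fun z => metricComponents g.val e z j l) y
      + partialDeriv j (fun z => metricComponents g.val e z i l) y
      - partialDeriv l (fun z => metricComponents g.val e z i j) y)

/-- The components of the Riemann curvature tensor in the chart `e`:
`R^l_{kij} = ∂_i Γ^l_{jk} - ∂_j Γ^l_{ik} + ∑_m (Γ^l_{im} Γ^m_{jk} - Γ^l_{jm} Γ^m_{ik})`. -/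
noncomputable def curvature (e : OpenPartialHomeomorph M (Fin n → ℝ)) (l k i j : Fin n)
    (y : Fin n → ℝ) : ℝ :=
  partialDeriv i (g.christoffel e l j k) y - partialDeriv j (g.christoffel e l i k) y
    + ∑ m, (g.christoffel e l i m y * g.christoffel e m j k y
      - g.christoffel e l j m y * g.christoffel e m i k y)

/-- The metric is flat: its Riemann curvature tensor vanishes. -/
def IsFlat : Prop :=
  ∀ e ∈ atlas (Fin n → ℝ) M, ∀ y ∈ e.target, ∀ l k i j : Fin n, g.curvature e l k i j y = 0

/-- The isometry group of `(M, g)` acts transitively on `M`. -/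
def IsHomogeneous : Prop :=
  ∀ p q : M, ∃ f : M ≃ₘ^∞⟮𝓘(ℝ, Fin n → ℝ), 𝓘(ℝ, Fin n → ℝ)⟯ M,
    f p = q ∧
    ∀ (x : M) (u v : Tan n x),
      g.val (f x) (mfderiv 𝓘(ℝ, Fin n → ℝ) 𝓘(ℝ, Fin n → ℝ) f x u)
        (mfderiv 𝓘(ℝ, Fin n → ℝ) 𝓘(ℝ, Fin n → ℝ) f x v) = g.val x u v

/-- The components in the chart `e` of the tangent vector `w`. -/
noncomputable def vectorComponents (e : OpenPartialHomeomorph M (Fin n → ℝ))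
    (w : TangentBundle 𝓘(ℝ, Fin n → ℝ) M) : Fin n → ℝ :=
  mfderiv 𝓘(ℝ, Fin n → ℝ) 𝓘(ℝ, Fin n → ℝ) e w.proj w.snd

/-- `W` is a smooth vector field along the curve `c = (W ·).proj` that is parallel for the
Levi-Civita connection: in every chart, `(W^k)' + ∑_{i,j} Γ^k_{ij}(c) (c^i)' W^j = 0`. -/
def IsParallel (W : ℝ → TangentBundle 𝓘(ℝ, Fin n → ℝ) M) : Prop :=
  ContMDiff 𝓘(ℝ, ℝ) (𝓘(ℝ, Fin n → ℝ)).tangent ∞ W ∧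
  ∀ e ∈ atlas (Fin n → ℝ) M, ∀ t : ℝ, (W t).proj ∈ e.source → ∀ k : Fin n,
    deriv (fun s => vectorComponents e (W s) k) t
      + ∑ i, ∑ j, g.christoffel e k i j (e (W t).proj)
        * deriv (fun s => e (W s).proj i) t * vectorComponents e (W t) j = 0

/-- The velocity vector of a curve, as a point of the tangent bundle. -/
noncomputable def velocity (c : ℝ → M) (t : ℝ) : TangentBundle 𝓘(ℝ, Fin n → ℝ) M :=
  ⟨c t, mfderiv 𝓘(ℝ, ℝ) 𝓘(ℝ, Fin n → ℝ) c t (1 : ℝ)⟩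

/-- A smooth curve, defined on all of `ℝ`, is a geodesic if its velocity is parallel along it. -/
def IsGeodesic (c : ℝ → M) : Prop :=
  ContMDiff 𝓘(ℝ, ℝ) 𝓘(ℝ, Fin n → ℝ) ∞ c ∧ g.IsParallel (velocity c)

/-- Geodesic completeness: every tangent vector is the initial velocity of a geodesic that is
defined for all times. -/
def IsComplete : Prop :=
  ∀ w : TangentBundle 𝓘(ℝ, Fin n → ℝ) M, ∃ c : ℝ → M, g.IsGeodesic c ∧ velocity c 0 = w

/-- `L` is the parallel transport along a smooth loop based at `p`. -/
def IsLoopTransport (p : M) (L : Tan n p ≃ₗ[ℝ] Tan n p) : Prop :=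
  ∃ c : ℝ → M, ContMDiff 𝓘(ℝ, ℝ) 𝓘(ℝ, Fin n → ℝ) ∞ c ∧ c 0 = p ∧ c 1 = p ∧
    ∀ v : Tan n p, ∃ W : ℝ → TangentBundle 𝓘(ℝ, Fin n → ℝ) M,
      g.IsParallel W ∧ (∀ t, (W t).proj = c t) ∧ W 0 = ⟨p, v⟩ ∧ W 1 = ⟨p, L v⟩

/-- The linear holonomy group at `p` of the Levi-Civita connection. (Piecewise smooth loops give
the same group: a piecewise smooth loop has a smooth reparametrization.) -/
noncomputable def holonomyGroup (p : M) : Subgroup (Tan n p ≃ₗ[ℝ] Tan n p) :=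
  Subgroup.closure {L | g.IsLoopTransport p L}

end PseudoRiemannianMetric

/-! ### Groups of affine transformations -/

/-- The linear holonomy group of a group of affine transformations: the group of linear parts. -/
def linearParts {n : ℕ} (Γ : Subgroup ((Fin n → ℝ) ≃ᵃ[ℝ] (Fin n → ℝ))) :
    Subgroup ((Fin n → ℝ) ≃ₗ[ℝ] (Fin n → ℝ)) :=
  Γ.map AffineEquiv.linearHom

/-- The orbit of a point under a group of affine transformations. -/
def affineOrbit {n : ℕ} (G : Subgroup ((Fin n → ℝ) ≃ᵃ[ℝ] (Fin n → ℝ))) (x : Fin n → ℝ) :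
    Set (Fin n → ℝ) :=
  {y | ∃ γ ∈ G, γ x = y}

/-- `Γ` preserves `U` and acts freely on it. -/
def ActsFreelyOn {n : ℕ} (Γ : Subgroup ((Fin n → ℝ) ≃ᵃ[ℝ] (Fin n → ℝ))) (U : Set (Fin n → ℝ)) :
    Prop :=
  (∀ γ ∈ Γ, γ '' U = U) ∧ ∀ γ ∈ Γ, ∀ x ∈ U, γ x = x → γ = 1

/-- `Γ` preserves `U` and acts properly discontinuously on it: for every compact `K ⊆ U`, only
finitely many `γ ∈ Γ` satisfy `γ K ∩ K ≠ ∅`. -/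
def ActsProperlyDiscontinuouslyOn {n : ℕ} (Γ : Subgroup ((Fin n → ℝ) ≃ᵃ[ℝ] (Fin n → ℝ)))
    (U : Set (Fin n → ℝ)) : Prop :=
  (∀ γ ∈ Γ, γ '' U = U) ∧
  ∀ K : Set (Fin n → ℝ), K ⊆ U → IsCompact K → {γ | γ ∈ Γ ∧ (γ '' K ∩ K).Nonempty}.Finite

/-- Two points of `U` are equivalent if they lie in the same `Γ`-orbit. -/
def orbitSetoid {n : ℕ} (Γ : Subgroup ((Fin n → ℝ) ≃ᵃ[ℝ] (Fin n → ℝ)))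
    (U : TopologicalSpace.Opens (Fin n → ℝ)) : Setoid U where
  r x y := ∃ γ ∈ Γ, γ x.1 = y.1
  iseqv :=
    { refl := fun _ => ⟨1, Γ.one_mem, rfl⟩
      symm := by
        rintro x y ⟨γ, hγ, h⟩
        exact ⟨γ⁻¹, Γ.inv_mem hγ, by rw [← h]; exact γ.symm_apply_apply x.1⟩
      trans := by
        rintro x y z ⟨γ, hγ, h⟩ ⟨δ, hδ, h'⟩
        exact ⟨δ * γ, Γ.mul_mem hδ hγ, by rw [← h', ← h]; rfl⟩ }

/-- The quotient space `U / Γ`, with the quotient topology. -/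
abbrev OrbitSpace {n : ℕ} (Γ : Subgroup ((Fin n → ℝ) ≃ᵃ[ℝ] (Fin n → ℝ)))
    (U : TopologicalSpace.Opens (Fin n → ℝ)) : Type :=
  Quotient (orbitSetoid Γ U)

/-- The projection `U → U / Γ`. -/
def orbitProj {n : ℕ} (Γ : Subgroup ((Fin n → ℝ) ≃ᵃ[ℝ] (Fin n → ℝ)))
    (U : TopologicalSpace.Opens (Fin n → ℝ)) : U → OrbitSpace Γ U :=
  Quotient.mk (orbitSetoid Γ U)

/-! ### The space `ℝ^{4,4}` and the group `Γ_{4,4}` -/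

/-- The matrix `Q` of the scalar product of signature `(4, 4)` in the chosen Witt basis. -/
def Q44 : Matrix (Fin 8) (Fin 8) ℝ :=
  !![0, 0, 0, 0,  0,  0, 1, 0;
     0, 0, 0, 0,  0,  0, 0, 1;
     0, 0, 1, 0,  0,  0, 0, 0;
     0, 0, 0, 1,  0,  0, 0, 0;
     0, 0, 0, 0, -1,  0, 0, 0;
     0, 0, 0, 0,  0, -1, 0, 0;
     1, 0, 0, 0,  0,  0, 0, 0;
     0, 1, 0, 0,  0,  0, 0, 0]

/-- The scalar product of `ℝ^{4,4}`. -/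
def form44 (x y : Fin 8 → ℝ) : ℝ := x ⬝ᵥ (Q44 *ᵥ y)

/-- `Iso(ℝ^{4,4})`: the affine transformations whose linear part preserves the scalar product. -/
def Iso44 : Subgroup ((Fin 8 → ℝ) ≃ᵃ[ℝ] (Fin 8 → ℝ)) where
  carrier := {γ | ∀ x y, form44 (γ.linear x) (γ.linear y) = form44 x y}
  one_mem' := fun _ _ => rfl
  mul_mem' := fun {γ δ} hγ hδ x y => (hγ (δ.linear x) (δ.linear y)).trans (hδ x y)
  inv_mem' := fun {γ} hγ x y => by
    have h := hγ (γ.linear.symm x) (γ.linear.symm y)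
    rw [LinearEquiv.apply_symm_apply, LinearEquiv.apply_symm_apply] at h
    exact h.symm

/-- The centralizer in `Iso(ℝ^{4,4})` of a group of affine transformations. -/
def centralizer44 (Γ : Subgroup ((Fin 8 → ℝ) ≃ᵃ[ℝ] (Fin 8 → ℝ))) :
    Subgroup ((Fin 8 → ℝ) ≃ᵃ[ℝ] (Fin 8 → ℝ)) :=
  Iso44 ⊓ Subgroup.centralizer (Γ : Set ((Fin 8 → ℝ) ≃ᵃ[ℝ] (Fin 8 → ℝ)))

/-- For `A² = 0`, the affine transformation `x ↦ (I + A) x + v`. -/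
def unipotentAffine {n : ℕ} (A : Matrix (Fin n) (Fin n) ℝ) (hA : A * A = 0) (v : Fin n → ℝ) :
    (Fin n → ℝ) ≃ᵃ[ℝ] (Fin n → ℝ) where
  toFun x := (1 + A) *ᵥ x + v
  invFun y := (1 - A) *ᵥ (y - v)
  left_inv x := by
    have h : (1 - A) * (1 + A) = 1 := by
      rw [sub_mul, one_mul, mul_add, mul_one, hA]; abel
    simp [Matrix.mulVec_mulVec, h]
  right_inv y := by
    have h : (1 + A) * (1 - A) = 1 := by
      rw [add_mul, one_mul, mul_sub, mul_one, hA]; abel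
    simp [Matrix.mulVec_mulVec, h]
  linear :=
    { toFun := fun x => (1 + A) *ᵥ x
      invFun := fun y => (1 - A) *ᵥ y
      map_add' := fun x y => Matrix.mulVec_add _ x y
      map_smul' := fun c x => Matrix.mulVec_smul _ c x
      left_inv := fun x => by
        have h : (1 - A) * (1 + A) = 1 := by
          rw [sub_mul, one_mul, mul_add, mul_one, hA]; abel
        simp [Matrix.mulVec_mulVec, h]
      right_inv := fun y => by
        have h : (1 + A) * (1 - A) = 1 := by
          rw [add_mul, one_mul, mul_sub, mul_one, hA]; abel
        simp [Matrix.mulVec_mulVec, h] }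
  map_vadd' x w := by
    simp [Matrix.mulVec_add, add_assoc]

/-- `A_1 = [[0, -B_1ᵀ Ĩ, 0], [0, 0, B_1], [0, 0, 0]]` with blocks of sizes `2, 4, 2`. -/
def A₁ : Matrix (Fin 8) (Fin 8) ℝ :=
  !![0, 0, 1, 0,  0, -1,  0,  0;
     0, 0, 0, 1, -1,  0,  0,  0;
     0, 0, 0, 0,  0,  0, -1,  0;
     0, 0, 0, 0,  0,  0,  0, -1;
     0, 0, 0, 0,  0,  0,  0, -1;
     0, 0, 0, 0,  0,  0, -1,  0;
     0, 0, 0, 0,  0,  0,  0,  0;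
     0, 0, 0, 0,  0,  0,  0,  0]

/-- `A_2 = [[0, -B_2ᵀ Ĩ, 0], [0, 0, B_2], [0, 0, 0]]` with blocks of sizes `2, 4, 2`. -/
def A₂ : Matrix (Fin 8) (Fin 8) ℝ :=
  !![0, 0, 0, -1, -1, 0,  0,  0;
     0, 0, 1,  0,  0, 1,  0,  0;
     0, 0, 0,  0,  0, 0,  0, -1;
     0, 0, 0,  0,  0, 0,  1,  0;
     0, 0, 0,  0,  0, 0, -1,  0;
     0, 0, 0,  0,  0, 0,  0,  1;
     0, 0, 0,  0,  0, 0,  0,  0;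
     0, 0, 0,  0,  0, 0,  0,  0]

theorem A₁_mul_self : A₁ * A₁ = 0 := by
  ext i j
  fin_cases i <;> fin_cases j <;> simp [A₁, Matrix.mul_apply, Fin.sum_univ_eight]

theorem A₂_mul_self : A₂ * A₂ = 0 := by
  ext i j
  fin_cases i <;> fin_cases j <;> simp [A₂, Matrix.mul_apply, Fin.sum_univ_eight]

/-- The generator `γ_1 = (I + A_1, (0, w_1, 0))`. -/
def gamma₁ : (Fin 8 → ℝ) ≃ᵃ[ℝ] (Fin 8 → ℝ) :=
  unipotentAffine A₁ A₁_mul_self ![0, 0, 1, 0, 0, 1, 0, 0]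

/-- The generator `γ_2 = (I + A_2, (0, w_2, 0))`. -/
def gamma₂ : (Fin 8 → ℝ) ≃ᵃ[ℝ] (Fin 8 → ℝ) :=
  unipotentAffine A₂ A₂_mul_self ![0, 0, 0, -1, 1, 0, 0, 0]

/-- The group `Γ_{4,4}` generated by `γ_1` and `γ_2`. -/
def Gamma44 : Subgroup ((Fin 8 → ℝ) ≃ᵃ[ℝ] (Fin 8 → ℝ)) :=
  Subgroup.closure {gamma₁, gamma₂}

/-- The discrete Heisenberg group: `(a, b, c)` stands for the integral unitriangular matrix
`[[1, a, c], [0, 1, b], [0, 0, 1]]`. -/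
@[ext] structure DiscreteHeisenberg where
  a : ℤ
  b : ℤ
  c : ℤ

namespace DiscreteHeisenberg

instance : Mul DiscreteHeisenberg := ⟨fun x y => ⟨x.a + y.a, x.b + y.b, x.c + y.c + x.a * y.b⟩⟩
instance : One DiscreteHeisenberg := ⟨⟨0, 0, 0⟩⟩
instance : Inv DiscreteHeisenberg := ⟨fun x => ⟨-x.a, -x.b, -x.c + x.a * x.b⟩⟩

theorem mul_def (x y : DiscreteHeisenberg) :
    x * y = ⟨x.a + y.a, x.b + y.b, x.c + y.c + x.a * y.b⟩ := rfl

theorem one_def : (1 : DiscreteHeisenberg) = ⟨0, 0, 0⟩ := rfl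

theorem inv_def (x : DiscreteHeisenberg) : x⁻¹ = ⟨-x.a, -x.b, -x.c + x.a * x.b⟩ := rfl

instance : Group DiscreteHeisenberg :=
  Group.ofLeftAxioms
    (fun x y z => by simp only [mul_def, mk.injEq]; refine ⟨by ring, by ring, by ring⟩)
    (fun x => by simp [mul_def, one_def])
    (fun x => by simp [mul_def, one_def, inv_def])

end DiscreteHeisenberg

/-! Write ζ = (x₆ - 1, x₇), u = (x₂ + x₅, x₃ + x₄), v = (x₃ - x₄, x₅ - x₂), w = (x₁, -x₀). Both
generators fix `heisCenter`, so the group is linear about that point. In these four copies of ℝ² the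
transformation with real parameters (a, b, m) reads ζ ↦ ζ, u ↦ u - 2aζ, v ↦ v + 2bζ, w ↦ w + av + bu
+ 2mζ. Where ζ ≠ 0, that is on `regularSet`, the inner products of u, v, w with ζ, divided by |ζ|²,
give three continuous functions that move as the coordinates of a translated point of the real
Heisenberg group (`heisCoordA_heisAffine` and its companions). Faithfulness, freeness and proper
discontinuity follow.

The centralizer contains SL₂(ℝ) acting diagonally on the four copies of ℝ², a four-parameter family
of unipotent shears, and the translations of the (x₀, x₁)-plane. Together these are transitive on
`regularSet` (`exists_centralizer44_apply_zero`). The complement is the fixed point set of a central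
element, hence invariant under the centralizer, and it has empty interior. So `regularSet` is the
only open orbit.

On the quotient, charts are local inverses of the projection, and transition maps are locally
elements of the group. The constant scalar product therefore descends to a metric with constant
components, and all Christoffel symbols vanish. Elements of the centralizer descend to isometries,
which gives homogeneity.

The coordinates x₆ and x₇ are invariant under the group. Hence the line through x and γx stays in U
and projects to a curve that is a loop on [0, 1], with the inverse of the linear part of γ as
transport up to conjugation (`isLoopTransport_orbitSpace`). Hence the holonomy is non-abelian. The
same invariants are affine in time along any geodesic (`exists_coord_of_isGeodesic`), so the
geodesic from 0 in direction e₆ would have to reach (x₆, x₇) = (1, 0) at time 1, which is excluded.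
-/

/-! ### Topology and smooth structure of the quotient of an open set by a free, properly
discontinuous affine action. -/

section OrbitSpace

open Topology Filter Set

variable {n : ℕ} {Γ : Subgroup ((Fin n → ℝ) ≃ᵃ[ℝ] (Fin n → ℝ))}
  {U : TopologicalSpace.Opens (Fin n → ℝ)}

theorem mem_of_image_eq (h : ∀ γ ∈ Γ, γ '' (U : Set (Fin n → ℝ)) = U)
    {γ : (Fin n → ℝ) ≃ᵃ[ℝ] (Fin n → ℝ)} (hγ : γ ∈ Γ) {x : Fin n → ℝ} (hx : x ∈ U) : γ x ∈ U := by
  have : γ x ∈ (U : Set (Fin n → ℝ)) := by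
    rw [← h γ hγ]; exact ⟨x, hx, rfl⟩
  exact this

/-- The action on an invariant open set of a group of affine transformations. -/
abbrev opensMulAction (h : ∀ γ ∈ Γ, γ '' (U : Set (Fin n → ℝ)) = U) : MulAction Γ U where
  smul γ x := ⟨γ.1 x.1, mem_of_image_eq h γ.2 x.2⟩
  one_smul _ := rfl
  mul_smul _ _ _ := rfl

/-- The bridge to the general theory of group actions. The two relations are written in opposite
directions, so symmetry is needed. -/
theorem orbitSetoid_eq_orbitRel (h : ∀ γ ∈ Γ, γ '' (U : Set (Fin n → ℝ)) = U) :
    orbitSetoid Γ U = @MulAction.orbitRel Γ U _ (opensMulAction h) := by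
  let := opensMulAction h
  ext x y
  rw [(orbitSetoid Γ U).comm', MulAction.orbitRel_apply]
  constructor
  · rintro ⟨γ, hγ, e⟩
    exact ⟨⟨γ, hγ⟩, Subtype.ext e⟩
  · rintro ⟨γ, e⟩
    exact ⟨γ.1, γ.2, congrArg Subtype.val e⟩

theorem continuousConstSMul_opens (h : ∀ γ ∈ Γ, γ '' (U : Set (Fin n → ℝ)) = U) :
    letI := opensMulAction h
    ContinuousConstSMul Γ U := by
  let := opensMulAction h
  exact ⟨fun γ => Continuous.subtype_mk
    (γ.1.continuous_of_finiteDimensional.comp continuous_subtype_val) _⟩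

theorem properlyDiscontinuousSMul_opens
    (h : ActsProperlyDiscontinuouslyOn Γ (U : Set (Fin n → ℝ))) :
    letI := opensMulAction h.1
    ProperlyDiscontinuousSMul Γ U := by
  let := opensMulAction h.1
  refine ⟨fun {K L} hK hL => ?_⟩
  -- The hypothesis concerns a single compact set, the class two of them; their union serves for
  -- both.
  have hKL : IsCompact (Subtype.val '' (K ∪ L) : Set (Fin n → ℝ)) :=
    (hK.union hL).image continuous_subtype_val
  have hfin := h.2 (Subtype.val '' (K ∪ L)) (by rintro _ ⟨x, -, rfl⟩; exact x.2) hKL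
  refine (hfin.preimage (f := (Subtype.val : Γ → _)) Subtype.val_injective.injOn).subset ?_
  rintro γ ⟨_, ⟨x, hx, rfl⟩, hxL⟩
  exact ⟨γ.2, γ.1 x.1, ⟨x.1, ⟨x, Or.inl hx, rfl⟩, rfl⟩, ⟨_, Or.inr hxL, rfl⟩⟩

theorem isCancelSMul_opens (h : ActsFreelyOn Γ (U : Set (Fin n → ℝ))) :
    letI := opensMulAction h.1
    IsCancelSMul Γ U := by
  let := opensMulAction h.1
  refine ⟨fun a b x hab => ?_⟩
  have hab' : a.1 x.1 = b.1 x.1 := congrArg Subtype.val hab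
  have := h.2 (b.1⁻¹ * a.1) (Γ.mul_mem (Γ.inv_mem b.2) a.2) x.1 x.2
    (by
      change b.1.symm (a.1 x.1) = x.1
      rw [hab']; exact b.1.symm_apply_apply _)
  exact Subtype.ext (inv_mul_eq_one.1 this).symm

theorem isOpenQuotientMap_orbitProj (h : ∀ γ ∈ Γ, γ '' (U : Set (Fin n → ℝ)) = U) :
    IsOpenQuotientMap (orbitProj Γ U) := by
  let := opensMulAction h
  have := continuousConstSMul_opens h
  unfold orbitProj OrbitSpace
  rw [orbitSetoid_eq_orbitRel h]
  exact MulAction.isOpenQuotientMap_quotientMk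

theorem t2Space_orbitSpace (h : ActsProperlyDiscontinuouslyOn Γ (U : Set (Fin n → ℝ))) :
    T2Space (OrbitSpace Γ U) := by
  let := opensMulAction h.1
  have := continuousConstSMul_opens h.1
  have := properlyDiscontinuousSMul_opens h
  have : LocallyCompactSpace U := U.2.locallyCompactSpace
  unfold OrbitSpace
  rw [orbitSetoid_eq_orbitRel h.1]
  infer_instance

theorem secondCountableTopology_orbitSpace (h : ∀ γ ∈ Γ, γ '' (U : Set (Fin n → ℝ)) = U) :
    SecondCountableTopology (OrbitSpace Γ U) :=
  (isOpenQuotientMap_orbitProj h).isQuotientMap.secondCountableTopology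
    (isOpenQuotientMap_orbitProj h).isOpenMap

theorem connectedSpace_orbitSpace (hU : IsConnected (U : Set (Fin n → ℝ))) :
    ConnectedSpace (OrbitSpace Γ U) := by
  have : ConnectedSpace U := isConnected_iff_connectedSpace.1 hU
  infer_instance

/-- A free, properly discontinuous action on a locally compact Hausdorff space has a covering map as
its quotient map. -/
theorem isLocalHomeomorph_orbitProj (hf : ActsFreelyOn Γ (U : Set (Fin n → ℝ)))
    (hp : ActsProperlyDiscontinuouslyOn Γ (U : Set (Fin n → ℝ))) :
    IsLocalHomeomorph (orbitProj Γ U) := by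
  let := opensMulAction hp.1
  have := continuousConstSMul_opens hp.1
  have := properlyDiscontinuousSMul_opens hp
  have := isCancelSMul_opens hf
  have : LocallyCompactSpace U := U.2.locallyCompactSpace
  unfold orbitProj OrbitSpace
  rw [orbitSetoid_eq_orbitRel hp.1]
  exact isQuotientCoveringMap_quotientMk_of_properlyDiscontinuousSMul.isCoveringMap.isLocalHomeomorph

variable (Γ U) in
/-- The projection `U → U / Γ`, extended arbitrarily to `ℝⁿ`. -/
noncomputable def orbitProjExt [Nonempty U] (y : Fin n → ℝ) : OrbitSpace Γ U :=
  open Classical in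
  if h : y ∈ U then orbitProj Γ U ⟨y, h⟩ else orbitProj Γ U (Classical.arbitrary U)

variable [Nonempty U]

theorem orbitProjExt_of_mem {y : Fin n → ℝ} (h : y ∈ U) :
    orbitProjExt Γ U y = orbitProj Γ U ⟨y, h⟩ := dif_pos h

theorem orbitProjExt_comp_val : orbitProjExt Γ U ∘ Subtype.val = orbitProj Γ U :=
  funext fun x => orbitProjExt_of_mem x.2

theorem exists_orbitProjExt_eq (p : OrbitSpace Γ U) : ∃ x ∈ U, orbitProjExt Γ U x = p := by
  obtain ⟨x, rfl⟩ := Quotient.exists_rep p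
  exact ⟨x.1, x.2, orbitProjExt_of_mem x.2⟩

theorem orbitProjExt_eq_iff {x y : Fin n → ℝ} (hx : x ∈ U) (hy : y ∈ U) :
    orbitProjExt Γ U x = orbitProjExt Γ U y ↔ ∃ γ ∈ Γ, γ x = y := by
  rw [orbitProjExt_of_mem hx, orbitProjExt_of_mem hy]
  exact Quotient.eq (r := orbitSetoid Γ U)

theorem orbitProjExt_apply (h : ∀ γ ∈ Γ, γ '' (U : Set (Fin n → ℝ)) = U)
    {γ : (Fin n → ℝ) ≃ᵃ[ℝ] (Fin n → ℝ)} (hγ : γ ∈ Γ) {x : Fin n → ℝ} (hx : x ∈ U) :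
    orbitProjExt Γ U (γ x) = orbitProjExt Γ U x :=
  ((orbitProjExt_eq_iff hx (mem_of_image_eq h hγ hx)).2 ⟨γ, hγ, rfl⟩).symm

variable (Γ U) in
/-- The charts of `U / Γ` that are inverse to the projection on an open subset of `U`. -/
def orbitAtlas : Set (OpenPartialHomeomorph (OrbitSpace Γ U) (Fin n → ℝ)) :=
  {e | e.target ⊆ U ∧ ∀ y ∈ e.target, e.symm y = orbitProjExt Γ U y}

theorem exists_mem_orbitAtlas (hloc : IsLocalHomeomorph (orbitProj Γ U)) {x : Fin n → ℝ}
    (hx : x ∈ U) : ∃ e ∈ orbitAtlas Γ U, x ∈ e.target := by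
  obtain ⟨e₀, hxe, he₀⟩ := hloc ⟨x, hx⟩
  -- The chart is a local inverse of the projection followed by the inclusion of U in ℝⁿ.
  refine ⟨e₀.symm.trans (U.openPartialHomeomorphSubtypeCoe inferInstance), ⟨?_, ?_⟩, ?_⟩
  · intro y hy
    have := hy.1
    simpa using this
  · intro y hy
    have hyU : y ∈ U := by simpa using hy.1
    have h1 : (U.openPartialHomeomorphSubtypeCoe inferInstance).symm y = ⟨y, hyU⟩ := by
      have := (U.openPartialHomeomorphSubtypeCoe inferInstance).left_inv (x := ⟨y, hyU⟩) (by simp)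
      simpa using this
    rw [orbitProjExt_of_mem hyU, he₀, OpenPartialHomeomorph.coe_trans_symm, Function.comp_apply, h1]
    rfl
  · have h1 : (U.openPartialHomeomorphSubtypeCoe inferInstance).symm x = ⟨x, hx⟩ := by
      have := (U.openPartialHomeomorphSubtypeCoe inferInstance).left_inv (x := ⟨x, hx⟩) (by simp)
      simpa using this
    rw [OpenPartialHomeomorph.trans_target]
    refine ⟨by simpa using hx, ?_⟩
    rw [mem_preimage, h1]
    exact hxe

theorem exists_chart (hloc : IsLocalHomeomorph (orbitProj Γ U)) (p : OrbitSpace Γ U) :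
    ∃ e ∈ orbitAtlas Γ U, p ∈ e.source := by
  obtain ⟨x, hx, rfl⟩ := exists_orbitProjExt_eq p
  obtain ⟨e, he, hxe⟩ := exists_mem_orbitAtlas hloc hx
  refine ⟨e, he, ?_⟩
  rw [← he.2 x hxe]
  exact e.map_target hxe

/-- The charted space structure of `U / Γ`. -/
noncomputable abbrev orbitChartedSpace (hloc : IsLocalHomeomorph (orbitProj Γ U)) :
    ChartedSpace (Fin n → ℝ) (OrbitSpace Γ U) where
  atlas := orbitAtlas Γ U
  chartAt p := (exists_chart hloc p).choose
  mem_chart_source p := (exists_chart hloc p).choose_spec.2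
  chart_mem_atlas p := (exists_chart hloc p).choose_spec.1

theorem map_source_of_mem_orbitAtlas {e : OpenPartialHomeomorph (OrbitSpace Γ U) (Fin n → ℝ)}
    (he : e ∈ orbitAtlas Γ U) {p : OrbitSpace Γ U} (hp : p ∈ e.source) :
    e p ∈ U ∧ orbitProjExt Γ U (e p) = p :=
  ⟨he.1 (e.map_source hp), by rw [← he.2 _ (e.map_source hp), e.left_inv hp]⟩

/-- In a chart of the atlas, the projection is locally given by an element of the group. -/
theorem exists_eventuallyEq_chart (h : ∀ γ ∈ Γ, γ '' (U : Set (Fin n → ℝ)) = U)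
    {e : OpenPartialHomeomorph (OrbitSpace Γ U) (Fin n → ℝ)} (he : e ∈ orbitAtlas Γ U)
    {x : Fin n → ℝ} (hx : x ∈ U) (hxe : orbitProjExt Γ U x ∈ e.source) :
    ∃ γ ∈ Γ, (fun y => e (orbitProjExt Γ U y)) =ᶠ[𝓝 x] γ := by
  obtain ⟨hU, hP⟩ := map_source_of_mem_orbitAtlas he hxe
  obtain ⟨γ, hγ, hγx⟩ := (orbitProjExt_eq_iff hx hU).1 hP.symm
  refine ⟨γ, hγ, ?_⟩
  have h1 : ∀ᶠ y in 𝓝 x, γ y ∈ e.target :=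
    γ.continuous_of_finiteDimensional.continuousAt.eventually
      (e.open_target.mem_nhds (hγx ▸ e.map_source hxe))
  filter_upwards [h1, U.2.mem_nhds hx] with y hy hyU
  rw [← orbitProjExt_apply h hγ hyU, ← he.2 _ hy, e.right_inv hy]

theorem AffineEquiv.contDiff_of_finiteDimensional {E F : Type*} [NormedAddCommGroup E]
    [NormedSpace ℝ E] [FiniteDimensional ℝ E] [NormedAddCommGroup F] [NormedSpace ℝ F]
    (f : E ≃ᵃ[ℝ] F) {k : WithTop ℕ∞} : ContDiff ℝ k f :=
  ContinuousAffineMap.contDiff ⟨f.toAffineMap, f.continuous_of_finiteDimensional⟩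

theorem AffineEquiv.hasFDerivAt_of_finiteDimensional {E F : Type*} [NormedAddCommGroup E]
    [NormedSpace ℝ E] [FiniteDimensional ℝ E] [NormedAddCommGroup F] [NormedSpace ℝ F]
    (f : E ≃ᵃ[ℝ] F) (x : E) :
    HasFDerivAt f (LinearMap.toContinuousLinearMap (f.linear : E →ₗ[ℝ] F)) x := by
  have h : (f : E → F) = fun y => LinearMap.toContinuousLinearMap (f.linear : E →ₗ[ℝ] F) y + f 0 := by
    ext y
    have := f.map_vadd 0 y
    simpa using this
  rw [h]
  exact (ContinuousLinearMap.hasFDerivAt _).add_const _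

/-- Two local inverses of the projection differ near each point by an element of the group, so
transition maps are locally affine. -/
theorem isManifold_orbitSpace (h : ∀ γ ∈ Γ, γ '' (U : Set (Fin n → ℝ)) = U)
    (hloc : IsLocalHomeomorph (orbitProj Γ U)) :
    @IsManifold ℝ _ (Fin n → ℝ) _ _ (Fin n → ℝ) _ 𝓘(ℝ, Fin n → ℝ) ∞ (OrbitSpace Γ U) _
      (orbitChartedSpace hloc) := by
  let := orbitChartedSpace hloc
  refine isManifold_of_contDiffOn _ _ _ fun e e' he he' => ?_
  intro y hy
  simp only [modelWithCornersSelf_coe_symm, Function.id_def, mem_inter_iff, mem_preimage] at hy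
  have hy1 : y ∈ e.target := hy.1.1
  have hy2 : e.symm y ∈ e'.source := hy.1.2
  rw [he.2 y hy1] at hy2
  obtain ⟨γ, hγ, hev⟩ := exists_eventuallyEq_chart h he' (he.1 hy1) hy2
  refine ContDiffAt.contDiffWithinAt ?_
  refine (γ.contDiff_of_finiteDimensional.contDiffAt).congr_of_eventuallyEq ?_
  filter_upwards [hev, e.open_target.mem_nhds hy1] with z hz hze
  rw [← hz, ← he.2 z hze]
  rfl

theorem continuousAt_orbitProjExt {x : Fin n → ℝ} (hx : x ∈ U) :
    ContinuousAt (orbitProjExt Γ U) x := by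
  have h : ContinuousOn (orbitProjExt Γ U) U := by
    rw [continuousOn_iff_continuous_domRestrict]
    have h1 : Continuous (orbitProjExt Γ U ∘ (Subtype.val : U → Fin n → ℝ)) := by
      rw [orbitProjExt_comp_val]
      exact continuous_quotient_mk'
    exact h1
  exact h.continuousAt (U.2.mem_nhds hx)

end OrbitSpace

/-! ### The induced flat metric on the quotient. -/

section OrbitGeometry

open Topology Filter Set PseudoRiemannianMetric

variable {n : ℕ} {Γ : Subgroup ((Fin n → ℝ) ≃ᵃ[ℝ] (Fin n → ℝ))}
  {U : TopologicalSpace.Opens (Fin n → ℝ)} [Nonempty U]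
  [ChartedSpace (Fin n → ℝ) (OrbitSpace Γ U)]

theorem contMDiffAt_orbitProjExt (h : ∀ γ ∈ Γ, γ '' (U : Set (Fin n → ℝ)) = U)
    (hat : atlas (Fin n → ℝ) (OrbitSpace Γ U) = orbitAtlas Γ U) {x : Fin n → ℝ} (hx : x ∈ U) :
    ContMDiffAt 𝓘(ℝ, Fin n → ℝ) 𝓘(ℝ, Fin n → ℝ) ∞ (orbitProjExt Γ U) x := by
  rw [contMDiffAt_iff]
  refine ⟨continuousAt_orbitProjExt hx, ?_⟩
  obtain ⟨γ, hγ, hev⟩ := exists_eventuallyEq_chart h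
    (hat ▸ chart_mem_atlas _ (orbitProjExt Γ U x)) hx (mem_chart_source _ _)
  refine ContDiffAt.contDiffWithinAt ?_
  exact γ.contDiff_of_finiteDimensional.contDiffAt.congr_of_eventuallyEq hev

theorem contMDiffOn_orbitProjExt (h : ∀ γ ∈ Γ, γ '' (U : Set (Fin n → ℝ)) = U)
    (hat : atlas (Fin n → ℝ) (OrbitSpace Γ U) = orbitAtlas Γ U) :
    ContMDiffOn 𝓘(ℝ, Fin n → ℝ) 𝓘(ℝ, Fin n → ℝ) ∞ (orbitProjExt Γ U) U :=
  fun _ hx => (contMDiffAt_orbitProjExt h hat hx).contMDiffWithinAt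

theorem mdifferentiableAt_orbitProjExt (h : ∀ γ ∈ Γ, γ '' (U : Set (Fin n → ℝ)) = U)
    (hat : atlas (Fin n → ℝ) (OrbitSpace Γ U) = orbitAtlas Γ U) {x : Fin n → ℝ} (hx : x ∈ U) :
    MDifferentiableAt 𝓘(ℝ, Fin n → ℝ) 𝓘(ℝ, Fin n → ℝ) (orbitProjExt Γ U) x :=
  (contMDiffAt_orbitProjExt h hat hx).mdifferentiableAt (by simp)

/-- In the preferred chart, the differential of the projection is the linear part of an element
of the group. -/
theorem exists_mfderiv_orbitProjExt (h : ∀ γ ∈ Γ, γ '' (U : Set (Fin n → ℝ)) = U)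
    (hat : atlas (Fin n → ℝ) (OrbitSpace Γ U) = orbitAtlas Γ U) {x : Fin n → ℝ} (hx : x ∈ U) :
    ∃ γ ∈ Γ, ∀ v : Fin n → ℝ,
      mfderiv 𝓘(ℝ, Fin n → ℝ) 𝓘(ℝ, Fin n → ℝ) (orbitProjExt Γ U) x v = γ.linear v := by
  obtain ⟨γ, hγ, hev⟩ := exists_eventuallyEq_chart h
    (hat ▸ chart_mem_atlas _ (orbitProjExt Γ U x)) hx (mem_chart_source _ _)
  refine ⟨γ, hγ, fun v => ?_⟩
  let L : (Fin n → ℝ) →L[ℝ] (Fin n → ℝ) :=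
    LinearMap.toContinuousLinearMap (γ.linear : (Fin n → ℝ) →ₗ[ℝ] (Fin n → ℝ))
  have hd : HasMFDerivAt 𝓘(ℝ, Fin n → ℝ) 𝓘(ℝ, Fin n → ℝ) (orbitProjExt Γ U) x L := by
    refine ⟨continuousAt_orbitProjExt hx, HasFDerivAt.hasFDerivWithinAt ?_⟩
    exact (γ.hasFDerivAt_of_finiteDimensional x).congr_of_eventuallyEq hev
  exact congrArg (fun T : (Fin n → ℝ) →L[ℝ] (Fin n → ℝ) => T v) hd.mfderiv

variable {B : (Fin n → ℝ) →ₗ[ℝ] (Fin n → ℝ) →ₗ[ℝ] ℝ}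

/-- The inverse of a chart is locally the projection, whose differential, read in the preferred
chart, is the linear part of some group element; `B` is invariant under it. So the components do not
depend on the point. -/
theorem metricComponents_orbitSpace (h : ∀ γ ∈ Γ, γ '' (U : Set (Fin n → ℝ)) = U)
    (hat : atlas (Fin n → ℝ) (OrbitSpace Γ U) = orbitAtlas Γ U)
    (hB : ∀ γ ∈ Γ, ∀ u v, B (γ.linear u) (γ.linear v) = B u v)
    {e : OpenPartialHomeomorph (OrbitSpace Γ U) (Fin n → ℝ)} (he : e ∈ atlas (Fin n → ℝ) _)
    {y : Fin n → ℝ} (hy : y ∈ e.target) (i j : Fin n) :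
    metricComponents (M := OrbitSpace Γ U) (fun _ => B) e y i j =
      B (Pi.single i 1) (Pi.single j 1) := by
  have he' : e ∈ orbitAtlas Γ U := hat ▸ he
  have hev : e.symm =ᶠ[𝓝 y] orbitProjExt Γ U := by
    filter_upwards [e.open_target.mem_nhds hy] with z hz using he'.2 z hz
  obtain ⟨γ, hγ, hd⟩ := exists_mfderiv_orbitProjExt h hat (he'.1 hy)
  have h1 : ∀ v : Fin n → ℝ,
      (mfderiv 𝓘(ℝ, Fin n → ℝ) 𝓘(ℝ, Fin n → ℝ) e.symm y v : Fin n → ℝ) = γ.linear v := by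
    intro v
    exact (congrArg (fun T : (Fin n → ℝ) →L[ℝ] (Fin n → ℝ) => T v) hev.mfderiv_eq).trans (hd v)
  rw [← hB γ hγ]
  exact congrArg₂ (fun u v => B u v) (h1 _) (h1 _)

theorem mfderiv_orbitProj (h : ∀ γ ∈ Γ, γ '' (U : Set (Fin n → ℝ)) = U)
    (hat : atlas (Fin n → ℝ) (OrbitSpace Γ U) = orbitAtlas Γ U) (x : U) :
    ∃ γ ∈ Γ, ∀ v : TangentSpace 𝓘(ℝ, Fin n → ℝ) x,
      (mfderiv 𝓘(ℝ, Fin n → ℝ) 𝓘(ℝ, Fin n → ℝ) (orbitProj Γ U) x v : Fin n → ℝ) =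
        γ.linear (mfderiv 𝓘(ℝ, Fin n → ℝ) 𝓘(ℝ, Fin n → ℝ)
          (Subtype.val : U → (Fin n → ℝ)) x v) := by
  obtain ⟨γ, hγ, hd⟩ := exists_mfderiv_orbitProjExt h hat x.2
  refine ⟨γ, hγ, fun v => ?_⟩
  have hval : MDifferentiableAt 𝓘(ℝ, Fin n → ℝ) 𝓘(ℝ, Fin n → ℝ)
      (Subtype.val : U → (Fin n → ℝ)) x :=
    (contMDiff_subtype_val (n := ∞) x).mdifferentiableAt (by simp)
  have h1 := mfderiv_comp x (mdifferentiableAt_orbitProjExt h hat x.2) hval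
  rw [orbitProjExt_comp_val] at h1
  exact (congrArg (fun T : (Fin n → ℝ) →L[ℝ] (Fin n → ℝ) => T v) h1).trans (hd _)

variable [IsManifold 𝓘(ℝ, Fin n → ℝ) ∞ (OrbitSpace Γ U)]

theorem contMDiffAt_chart {M : Type*} [TopologicalSpace M] [ChartedSpace (Fin n → ℝ) M]
    [IsManifold 𝓘(ℝ, Fin n → ℝ) ∞ M] {e : OpenPartialHomeomorph M (Fin n → ℝ)}
    (he : e ∈ atlas (Fin n → ℝ) M) {p : M} (hp : p ∈ e.source) :
    ContMDiffAt 𝓘(ℝ, Fin n → ℝ) 𝓘(ℝ, Fin n → ℝ) ∞ e p :=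
  contMDiffAt_of_mem_maximalAtlas (IsManifold.subset_maximalAtlas he) hp

/-- One γ serves for all points near x. This makes the chart components of the image of a constant
vector locally constant. -/
theorem exists_mfderiv_chart (h : ∀ γ ∈ Γ, γ '' (U : Set (Fin n → ℝ)) = U)
    (hat : atlas (Fin n → ℝ) (OrbitSpace Γ U) = orbitAtlas Γ U)
    {e : OpenPartialHomeomorph (OrbitSpace Γ U) (Fin n → ℝ)} (he : e ∈ atlas (Fin n → ℝ) _)
    {x : Fin n → ℝ} (hx : x ∈ U) (hxe : orbitProjExt Γ U x ∈ e.source) :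
    ∃ γ ∈ Γ, ∀ᶠ y in 𝓝 x, ∀ v : Fin n → ℝ,
      (mfderiv 𝓘(ℝ, Fin n → ℝ) 𝓘(ℝ, Fin n → ℝ) e (orbitProjExt Γ U y)
        (mfderiv 𝓘(ℝ, Fin n → ℝ) 𝓘(ℝ, Fin n → ℝ) (orbitProjExt Γ U) y v) : Fin n → ℝ) =
        γ.linear v := by
  obtain ⟨γ, hγ, hev⟩ := exists_eventuallyEq_chart h (hat ▸ he) hx hxe
  refine ⟨γ, hγ, ?_⟩
  filter_upwards [hev.eventuallyEq_nhds, U.2.mem_nhds hx,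
    (continuousAt_orbitProjExt hx).eventually (e.open_source.mem_nhds hxe)] with y hy hyU hye v
  have h1 := mfderiv_comp y ((contMDiffAt_chart he hye).mdifferentiableAt (by simp))
    (mdifferentiableAt_orbitProjExt h hat hyU)
  have h2 : mfderiv 𝓘(ℝ, Fin n → ℝ) 𝓘(ℝ, Fin n → ℝ) (e ∘ orbitProjExt Γ U) y =
      LinearMap.toContinuousLinearMap (γ.linear : (Fin n → ℝ) →ₗ[ℝ] (Fin n → ℝ)) := by
    rw [mfderiv_eq_fderiv]
    exact ((γ.hasFDerivAt_of_finiteDimensional y).congr_of_eventuallyEq hy).fderiv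
  have h3 := congrArg (fun T : (Fin n → ℝ) →L[ℝ] (Fin n → ℝ) => T v) (h1.symm.trans h2)
  exact h3

/-- The metric on `U / Γ` induced by a `Γ`-invariant scalar product. -/
noncomputable def orbitMetric (h : ∀ γ ∈ Γ, γ '' (U : Set (Fin n → ℝ)) = U)
    (hat : atlas (Fin n → ℝ) (OrbitSpace Γ U) = orbitAtlas Γ U)
    (hB : ∀ γ ∈ Γ, ∀ u v, B (γ.linear u) (γ.linear v) = B u v)
    (hsymm : ∀ u v, B u v = B v u) (hnd : ∀ u, (∀ v, B u v = 0) → u = 0) :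
    PseudoRiemannianMetric n (OrbitSpace Γ U) where
  -- Every tangent space is ℝⁿ by definition, identified through the preferred chart; since charts
  -- differ by maps preserving `B`, the constant form is a well-behaved choice.
  val _ := B
  symm _ := hsymm
  nondegenerate _ := hnd
  smooth e he i j := by
    refine contDiffOn_const (c := B (Pi.single i 1) (Pi.single j 1)) |>.congr fun y hy => ?_
    exact metricComponents_orbitSpace h hat hB he hy i j

theorem partialDeriv_eq_zero {f : (Fin n → ℝ) → ℝ} {y : Fin n → ℝ} {c : ℝ}
    (hf : f =ᶠ[𝓝 y] fun _ => c) (i : Fin n) : partialDeriv i f y = 0 := by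
  rw [partialDeriv, hf.fderiv_eq]
  simp

theorem isLocalDiffeomorph_orbitProj (h : ∀ γ ∈ Γ, γ '' (U : Set (Fin n → ℝ)) = U)
    (hloc : IsLocalHomeomorph (orbitProj Γ U))
    (hat : atlas (Fin n → ℝ) (OrbitSpace Γ U) = orbitAtlas Γ U) :
    IsLocalDiffeomorph 𝓘(ℝ, Fin n → ℝ) 𝓘(ℝ, Fin n → ℝ) ∞ (orbitProj Γ U) := by
  intro x
  obtain ⟨e, he, hxe⟩ := exists_mem_orbitAtlas hloc x.2
  have hea : e ∈ atlas (Fin n → ℝ) (OrbitSpace Γ U) := hat ▸ he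
  classical
  -- The chart with values in U; the default `x` is never taken on `e.source`.
  let inv : OrbitSpace Γ U → U := fun p => if hp : e p ∈ U then ⟨e p, hp⟩ else x
  have hinv : ∀ p ∈ e.source, (inv p).1 = e p := fun p hp => by
    have : e p ∈ U := he.1 (e.map_source hp)
    simp [inv, this]
  have hP : ∀ y : U, y.1 ∈ e.target → orbitProj Γ U y = e.symm y.1 := fun y hy => by
    rw [he.2 _ hy, orbitProjExt_of_mem y.2]
  refine ⟨{ toFun := orbitProj Γ U
            invFun := inv
            source := Subtype.val ⁻¹' e.target
            target := e.source
            map_source' := fun y hy => ?_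
            map_target' := fun p hp => ?_
            left_inv' := fun y hy => ?_
            right_inv' := fun p hp => ?_
            open_source := e.open_target.preimage continuous_subtype_val
            open_target := e.open_source
            contMDiffOn_toFun := ?_
            contMDiffOn_invFun := ?_ }, hxe, fun _ _ => rfl⟩
  · rw [hP y hy]; exact e.map_target hy
  · change (inv p).1 ∈ e.target
    rw [hinv p hp]; exact e.map_source hp
  · have hy' : e.symm y.1 ∈ e.source := e.map_target hy
    apply Subtype.ext
    rw [hP y hy, hinv _ hy', e.right_inv hy]
  · have : (inv p).1 ∈ e.target := by rw [hinv p hp]; exact e.map_source hp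
    rw [hP _ this, hinv p hp, e.left_inv hp]
  · intro y _
    refine ContMDiffAt.contMDiffWithinAt ?_
    have := contMDiffAt_subtype_iff.2 (contMDiffAt_orbitProjExt h hat y.2)
    rw [← orbitProjExt_comp_val]
    exact this
  · intro p hp
    refine ContMDiffAt.contMDiffWithinAt ?_
    rw [← ContMDiffAt.subtypeVal_comp_iff]
    refine (contMDiffAt_chart hea hp).congr_of_eventuallyEq ?_
    filter_upwards [e.open_source.mem_nhds hp] with q hq using hinv q hq

section Metric

variable {g : PseudoRiemannianMetric n (OrbitSpace Γ U)}

theorem christoffel_orbitSpace (h : ∀ γ ∈ Γ, γ '' (U : Set (Fin n → ℝ)) = U)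
    (hat : atlas (Fin n → ℝ) (OrbitSpace Γ U) = orbitAtlas Γ U)
    (hB : ∀ γ ∈ Γ, ∀ u v, B (γ.linear u) (γ.linear v) = B u v) (hg : g.val = fun _ => B)
    {e : OpenPartialHomeomorph (OrbitSpace Γ U) (Fin n → ℝ)} (he : e ∈ atlas (Fin n → ℝ) _)
    {y : Fin n → ℝ} (hy : y ∈ e.target) (k i j : Fin n) :
    g.christoffel e k i j y = 0 := by
  have h0 : ∀ l i j, partialDeriv l (fun z => metricComponents g.val e z i j) y = 0 := by
    intro l i j
    refine partialDeriv_eq_zero (c := B (Pi.single i 1) (Pi.single j 1)) ?_ l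
    filter_upwards [e.open_target.mem_nhds hy] with z hz
    rw [hg]
    exact metricComponents_orbitSpace h hat hB he hz i j
  simp only [christoffel, h0]
  simp

theorem isFlat_orbitSpace (h : ∀ γ ∈ Γ, γ '' (U : Set (Fin n → ℝ)) = U)
    (hat : atlas (Fin n → ℝ) (OrbitSpace Γ U) = orbitAtlas Γ U)
    (hB : ∀ γ ∈ Γ, ∀ u v, B (γ.linear u) (γ.linear v) = B u v) (hg : g.val = fun _ => B) :
    g.IsFlat := by
  intro e he y hy l k i j
  have h0 : ∀ k i j, ∀ z ∈ e.target, g.christoffel e k i j z = 0 :=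
    fun k i j z hz => christoffel_orbitSpace h hat hB hg he hz k i j
  have h1 : ∀ m k i j, partialDeriv m (g.christoffel e k i j) y = 0 := by
    intro m k i j
    refine partialDeriv_eq_zero (c := 0) ?_ m
    filter_upwards [e.open_target.mem_nhds hy] with z hz using h0 k i j z hz
  simp only [curvature, h1, h0 _ _ _ y hy]
  simp

end Metric

end OrbitGeometry

/-! ### Isometries, geodesics and holonomy of the quotient. -/

section OrbitGlobal

open Topology Filter Set PseudoRiemannianMetric

variable {n : ℕ} {Γ : Subgroup ((Fin n → ℝ) ≃ᵃ[ℝ] (Fin n → ℝ))}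
  {U : TopologicalSpace.Opens (Fin n → ℝ)} [Nonempty U]

/-- The self-map of `U / Γ` induced by an affine transformation. -/
noncomputable def orbitMap (f : (Fin n → ℝ) ≃ᵃ[ℝ] (Fin n → ℝ)) (p : OrbitSpace Γ U) :
    OrbitSpace Γ U :=
  orbitProjExt Γ U (f (exists_orbitProjExt_eq p).choose)

/-- Since f commutes with the group, the choice of representative does not affect the image. -/
theorem orbitMap_orbitProjExt {f : (Fin n → ℝ) ≃ᵃ[ℝ] (Fin n → ℝ)}
    (hf : ∀ γ ∈ Γ, ∀ x, f (γ x) = γ (f x)) (hU : ∀ x ∈ U, f x ∈ U) {x : Fin n → ℝ} (hx : x ∈ U) :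
    orbitMap f (orbitProjExt Γ U x) = orbitProjExt Γ U (f x) := by
  have hc := (exists_orbitProjExt_eq (orbitProjExt Γ U x)).choose_spec
  obtain ⟨γ, hγ, e⟩ := (orbitProjExt_eq_iff hc.1 hx).1 hc.2
  exact (orbitProjExt_eq_iff (hU _ hc.1) (hU _ hx)).2 ⟨γ, hγ, by rw [← hf γ hγ, e]⟩

variable [ChartedSpace (Fin n → ℝ) (OrbitSpace Γ U)]
  {B : (Fin n → ℝ) →ₗ[ℝ] (Fin n → ℝ) →ₗ[ℝ] ℝ}

theorem exists_mfderiv_orbitProjExt_equiv (h : ∀ γ ∈ Γ, γ '' (U : Set (Fin n → ℝ)) = U)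
    (hat : atlas (Fin n → ℝ) (OrbitSpace Γ U) = orbitAtlas Γ U)
    (hB : ∀ γ ∈ Γ, ∀ u v, B (γ.linear u) (γ.linear v) = B u v)
    {x : Fin n → ℝ} (hx : x ∈ U) :
    ∃ D : (Fin n → ℝ) ≃ₗ[ℝ] (Fin n → ℝ), (∀ u v, B (D u) (D v) = B u v) ∧ ∀ v : Fin n → ℝ,
      mfderiv 𝓘(ℝ, Fin n → ℝ) 𝓘(ℝ, Fin n → ℝ) (orbitProjExt Γ U) x v = D v := by
  obtain ⟨γ, hγ, hd⟩ := exists_mfderiv_orbitProjExt h hat hx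
  exact ⟨γ.linear, hB γ hγ, hd⟩

variable [IsManifold 𝓘(ℝ, Fin n → ℝ) ∞ (OrbitSpace Γ U)]
  {g : PseudoRiemannianMetric n (OrbitSpace Γ U)}

theorem contMDiff_orbitMap (h : ∀ γ ∈ Γ, γ '' (U : Set (Fin n → ℝ)) = U)
    (hat : atlas (Fin n → ℝ) (OrbitSpace Γ U) = orbitAtlas Γ U)
    {f : (Fin n → ℝ) ≃ᵃ[ℝ] (Fin n → ℝ)} (hf : ∀ γ ∈ Γ, ∀ x, f (γ x) = γ (f x))
    (hU : ∀ x ∈ U, f x ∈ U) :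
    ContMDiff 𝓘(ℝ, Fin n → ℝ) 𝓘(ℝ, Fin n → ℝ) ∞ (orbitMap (Γ := Γ) (U := U) f) := by
  intro p
  have he := chart_mem_atlas (Fin n → ℝ) p
  have hp := mem_chart_source (Fin n → ℝ) p
  set e := chartAt (Fin n → ℝ) p
  have he' : e ∈ orbitAtlas Γ U := hat ▸ he
  have h1 : ContMDiffAt 𝓘(ℝ, Fin n → ℝ) 𝓘(ℝ, Fin n → ℝ) ∞ (f ∘ e) p :=
    ContMDiffAt.comp p f.contDiff_of_finiteDimensional.contDiffAt.contMDiffAt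
      (contMDiffAt_chart he hp)
  have h2 : ContMDiffAt 𝓘(ℝ, Fin n → ℝ) 𝓘(ℝ, Fin n → ℝ) ∞ (orbitProjExt Γ U ∘ f ∘ e) p :=
    ContMDiffAt.comp p (contMDiffAt_orbitProjExt h hat
      (hU _ (map_source_of_mem_orbitAtlas he' hp).1)) h1
  refine h2.congr_of_eventuallyEq ?_
  filter_upwards [e.open_source.mem_nhds hp] with q hq
  obtain ⟨hqU, hqP⟩ := map_source_of_mem_orbitAtlas he' hq
  conv_lhs => rw [← hqP]
  exact orbitMap_orbitProjExt hf hU hqU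

theorem isHomogeneous_orbitSpace (h : ∀ γ ∈ Γ, γ '' (U : Set (Fin n → ℝ)) = U)
    (hat : atlas (Fin n → ℝ) (OrbitSpace Γ U) = orbitAtlas Γ U)
    (hB : ∀ γ ∈ Γ, ∀ u v, B (γ.linear u) (γ.linear v) = B u v) (hg : g.val = fun _ => B)
    (ht : ∀ x ∈ U, ∀ y ∈ U, ∃ f : (Fin n → ℝ) ≃ᵃ[ℝ] (Fin n → ℝ), f x = y ∧
      (∀ γ ∈ Γ, ∀ x, f (γ x) = γ (f x)) ∧ f '' (U : Set (Fin n → ℝ)) = U ∧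
      ∀ u v, B (f.linear u) (f.linear v) = B u v) :
    g.IsHomogeneous := by
  intro p q
  obtain ⟨x, hx, rfl⟩ := exists_orbitProjExt_eq p
  obtain ⟨y, hy, rfl⟩ := exists_orbitProjExt_eq q
  obtain ⟨f, rfl, hf, hfU, hfB⟩ := ht x hx y hy
  have hU : ∀ x ∈ U, f x ∈ U := fun x hx => by
    have : f x ∈ (U : Set (Fin n → ℝ)) := hfU ▸ mem_image_of_mem f hx
    exact this
  have hU' : ∀ x ∈ U, f.symm x ∈ U := fun x hx => by
    obtain ⟨z, hz, hzx⟩ : x ∈ f '' (U : Set (Fin n → ℝ)) := by rw [hfU]; exact hx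
    rw [← hzx, f.symm_apply_apply]
    exact hz
  have hf' : ∀ γ ∈ Γ, ∀ x, f.symm (γ x) = γ (f.symm x) := fun γ hγ x => by
    apply f.injective
    rw [f.apply_symm_apply, hf γ hγ, f.apply_symm_apply]
  refine ⟨⟨⟨orbitMap f, orbitMap f.symm, fun p => ?_, fun p => ?_⟩, contMDiff_orbitMap h hat hf hU,
    contMDiff_orbitMap h hat hf' hU'⟩, orbitMap_orbitProjExt hf hU hx, fun p u v => ?_⟩
  · obtain ⟨x, hx, rfl⟩ := exists_orbitProjExt_eq p
    rw [orbitMap_orbitProjExt hf hU hx, orbitMap_orbitProjExt hf' hU' (hU x hx),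
      f.symm_apply_apply]
  · obtain ⟨x, hx, rfl⟩ := exists_orbitProjExt_eq p
    rw [orbitMap_orbitProjExt hf' hU' hx, orbitMap_orbitProjExt hf hU (hU' x hx),
      f.apply_symm_apply]
  · obtain ⟨x, hx, rfl⟩ := exists_orbitProjExt_eq p
    rw [hg]
    obtain ⟨D, hDB, hD⟩ := exists_mfderiv_orbitProjExt_equiv h hat hB hx
    obtain ⟨D', hDB', hD'⟩ := exists_mfderiv_orbitProjExt_equiv h hat hB (hU x hx)
    -- Differentiating this relation at x expresses the differential of the descended map through
    -- the linear part of f and two maps that preserve `B`.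
    have hev : orbitMap f ∘ orbitProjExt Γ U =ᶠ[𝓝 x] orbitProjExt Γ U ∘ f := by
      filter_upwards [U.2.mem_nhds hx] with z hz using orbitMap_orbitProjExt hf hU hz
    have hfd : HasMFDerivAt 𝓘(ℝ, Fin n → ℝ) 𝓘(ℝ, Fin n → ℝ) f x _ :=
      (f.hasFDerivAt_of_finiteDimensional x).hasMFDerivAt
    have h1 := mfderiv_comp x
      (((contMDiff_orbitMap h hat hf hU) (orbitProjExt Γ U x)).mdifferentiableAt (by simp))
      (mdifferentiableAt_orbitProjExt h hat hx)
    have h2 := mfderiv_comp x (mdifferentiableAt_orbitProjExt h hat (hU x hx))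
      hfd.mdifferentiableAt
    have h3 : ∀ w : Fin n → ℝ, (mfderiv 𝓘(ℝ, Fin n → ℝ) 𝓘(ℝ, Fin n → ℝ)
        (orbitMap (Γ := Γ) (U := U) f) (orbitProjExt Γ U x) (D w) : Fin n → ℝ) =
        D' (f.linear w) := by
      intro w
      rw [← hD w, ← hD' (f.linear w)]
      have := congrArg (fun T : (Fin n → ℝ) →L[ℝ] (Fin n → ℝ) => T w)
        ((h1.symm.trans hev.mfderiv_eq).trans h2)
      refine this.trans ?_
      exact congrArg (fun T : (Fin n → ℝ) →L[ℝ] (Fin n → ℝ) =>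
        (mfderiv 𝓘(ℝ, Fin n → ℝ) 𝓘(ℝ, Fin n → ℝ) (orbitProjExt Γ U) (f x) (T w) : Fin n → ℝ))
        hfd.mfderiv
    have h4 : ∀ u v : Fin n → ℝ, B (mfderiv 𝓘(ℝ, Fin n → ℝ) 𝓘(ℝ, Fin n → ℝ)
        (orbitMap (Γ := Γ) (U := U) f) (orbitProjExt Γ U x) u : Fin n → ℝ)
        (mfderiv 𝓘(ℝ, Fin n → ℝ) 𝓘(ℝ, Fin n → ℝ)
        (orbitMap (Γ := Γ) (U := U) f) (orbitProjExt Γ U x) v : Fin n → ℝ) = B u v := by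
      intro u v
      obtain ⟨u, rfl⟩ := D.surjective u
      obtain ⟨v, rfl⟩ := D.surjective v
      refine (congrArg₂ (fun u v => B u v) (h3 u) (h3 v)).trans ?_
      rw [hDB', hfB, hDB]
    exact h4 u v

/-- Along a geodesic of `U / Γ` defined for all times, the `Γ`-invariant coordinates are affine
functions of time. -/
theorem exists_coord_of_isGeodesic (h : ∀ γ ∈ Γ, γ '' (U : Set (Fin n → ℝ)) = U)
    (hat : atlas (Fin n → ℝ) (OrbitSpace Γ U) = orbitAtlas Γ U)
    (hB : ∀ γ ∈ Γ, ∀ u v, B (γ.linear u) (γ.linear v) = B u v) (hg : g.val = fun _ => B)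
    {c : ℝ → OrbitSpace Γ U} (hc : g.IsGeodesic c) {x₀ : Fin n → ℝ} (hx₀ : x₀ ∈ U)
    {v : Fin n → ℝ} (hv : velocity c 0 = ⟨orbitProjExt Γ U x₀,
      mfderiv 𝓘(ℝ, Fin n → ℝ) 𝓘(ℝ, Fin n → ℝ) (orbitProjExt Γ U) x₀ v⟩) (t : ℝ) :
    ∃ x ∈ U, ∀ k, (∀ γ ∈ Γ, ∀ x, γ x k = x k) → x k = x₀ k + t * v k := by
  refine ⟨_, (exists_orbitProjExt_eq (c t)).choose_spec.1, fun k hk => ?_⟩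
  -- The invariant coordinate descends to a function on the quotient; invariance makes it
  -- independent of the chosen representative.
  set κ : OrbitSpace Γ U → ℝ := fun p => (exists_orbitProjExt_eq p).choose k with hκ
  have hκP : ∀ x ∈ U, κ (orbitProjExt Γ U x) = x k := by
    intro x hx
    have hs := (exists_orbitProjExt_eq (orbitProjExt Γ U x)).choose_spec
    obtain ⟨γ, hγ, e⟩ := (orbitProjExt_eq_iff hs.1 hx).1 hs.2
    exact (hk γ hγ _).symm.trans (congrFun e k)
  have hlin : ∀ γ ∈ Γ, ∀ v : Fin n → ℝ, γ.linear v k = v k := by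
    intro γ hγ v
    have e := congrFun (γ.map_vadd 0 v) k
    have e' := hk γ hγ (v +ᵥ (0 : Fin n → ℝ))
    have e'' := hk γ hγ 0
    simp only [vadd_eq_add, Pi.add_apply, Pi.zero_apply, add_zero] at e e' e''
    linarith
  have hloc : ∀ t, ∀ e ∈ atlas (Fin n → ℝ) (OrbitSpace Γ U), c t ∈ e.source →
      (κ ∘ c =ᶠ[𝓝 t] fun s => e (c s) k) ∧ ContDiffAt ℝ ∞ (fun s => e (c s)) t ∧
      deriv (κ ∘ c) t = vectorComponents e (velocity c t) k := by
    intro t e he hte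
    have he' : e ∈ orbitAtlas Γ U := hat ▸ he
    have hct : ContMDiffAt 𝓘(ℝ, ℝ) 𝓘(ℝ, Fin n → ℝ) ∞ c t := hc.1 t
    have h1 : κ ∘ c =ᶠ[𝓝 t] fun s => e (c s) k := by
      filter_upwards [hct.continuousAt.eventually (e.open_source.mem_nhds hte)] with s hs
      obtain ⟨hsU, hsP⟩ := map_source_of_mem_orbitAtlas he' hs
      rw [Function.comp_apply, ← hsP, hκP _ hsU, hsP]
    have h2 : ContMDiffAt 𝓘(ℝ, ℝ) 𝓘(ℝ, Fin n → ℝ) ∞ (e ∘ c) t :=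
      (contMDiffAt_chart he hte).comp t hct
    refine ⟨h1, h2.contDiffAt, ?_⟩
    rw [h1.deriv_eq]
    have h3 := mfderiv_comp t ((contMDiffAt_chart he hte).mdifferentiableAt (by simp))
      (hct.mdifferentiableAt (by simp))
    rw [mfderiv_eq_fderiv] at h3
    have hd : HasDerivAt (e ∘ c) (fderiv ℝ (e ∘ c) t 1) t :=
      (h2.contDiffAt.differentiableAt (by simp)).hasFDerivAt.hasDerivAt
    have h4 := ((hasDerivAt_pi.1 hd) k).deriv
    refine h4.trans ?_
    exact congrArg (fun T : ℝ →L[ℝ] (Fin n → ℝ) => T 1 k) h3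
  have hsm : ContDiff ℝ ∞ (κ ∘ c) := by
    rw [contDiff_iff_contDiffAt]
    intro t
    obtain ⟨h1, h2, -⟩ := hloc t _ (chart_mem_atlas _ (c t)) (mem_chart_source _ _)
    exact ((contDiffAt_pi.1 h2) k).congr_of_eventuallyEq h1
  -- With vanishing Christoffel symbols the geodesic equation says that the chart components of the
  -- velocity have derivative zero.
  have hdd : ∀ t, deriv (deriv (κ ∘ c)) t = 0 := by
    intro t
    have he := chart_mem_atlas (Fin n → ℝ) (c t)
    have hte := mem_chart_source (Fin n → ℝ) (c t)
    set e := chartAt (Fin n → ℝ) (c t)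
    have h1 : deriv (κ ∘ c) =ᶠ[𝓝 t] fun s => vectorComponents e (velocity c s) k := by
      filter_upwards [(hc.1 t).continuousAt.eventually (e.open_source.mem_nhds hte)] with s hs
      exact (hloc s e he hs).2.2
    rw [h1.deriv_eq]
    have h2 := hc.2.2 e he t hte k
    have hy : e (velocity (n := n) c t).proj ∈ e.target := e.map_source hte
    have h3 : ∀ i j, g.christoffel e k i j (e (velocity (n := n) c t).proj) = 0 := fun i j =>
      christoffel_orbitSpace h hat hB hg he hy k i j
    simpa [h3] using h2
  have hd0 : deriv (κ ∘ c) 0 = v k := by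
    have hc0 : c 0 = orbitProjExt Γ U x₀ := congrArg Bundle.TotalSpace.proj hv
    have he := chart_mem_atlas (Fin n → ℝ) (c 0)
    have hte := mem_chart_source (Fin n → ℝ) (c 0)
    rw [(hloc 0 _ he hte).2.2, hv]
    obtain ⟨γ, hγ, hev⟩ := exists_mfderiv_chart h hat he hx₀ (hc0 ▸ hte)
    exact (congrFun (hev.self_of_nhds v) k).trans (hlin γ hγ v)
  have hdc : ∀ t, deriv (κ ∘ c) t = v k := fun t => by
    rw [← hd0]
    refine is_const_of_deriv_eq_zero ?_ hdd t 0
    exact (contDiff_infty_iff_deriv.1 hsm).2.differentiable (by simp)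
  have hF : ∀ t, deriv (fun s => (κ ∘ c) s - s * v k) t = 0 := fun t => by
    have h1 : HasDerivAt (κ ∘ c) (v k) t := by
      rw [← hdc t]; exact (hsm.differentiable (by simp) t).hasDerivAt
    have h2 := h1.sub ((hasDerivAt_id t).mul_const (v k))
    rw [one_mul, sub_self] at h2
    exact h2.deriv
  have hconst := is_const_of_deriv_eq_zero
    ((hsm.differentiable (by simp)).sub (differentiable_id.mul_const (v k))) hF t 0
  have hc0 : c 0 = orbitProjExt Γ U x₀ := congrArg Bundle.TotalSpace.proj hv
  have h0 : κ (c 0) = x₀ k := by rw [hc0, hκP x₀ hx₀]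
  simp only [Function.comp_apply, Pi.sub_apply, zero_mul, sub_zero, h0] at hconst
  have : κ (c t) = x₀ k + t * v k := by linarith
  exact this

theorem contMDiff_tangentBundle_curve {c : ℝ → Fin n → ℝ} (hc : ContDiff ℝ ∞ c) (v : Fin n → ℝ) :
    ContMDiff 𝓘(ℝ, ℝ) (𝓘(ℝ, Fin n → ℝ)).tangent ∞
      (fun t => (⟨c t, v⟩ : TangentBundle 𝓘(ℝ, Fin n → ℝ) (Fin n → ℝ))) := by
  intro t
  rw [Bundle.contMDiffAt_totalSpace]
  refine ⟨hc.contMDiff t, ?_⟩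
  simp only [trivializationAt_model_space_apply]
  exact contMDiffAt_const

theorem isLoopTransport_orbitSpace (h : ∀ γ ∈ Γ, γ '' (U : Set (Fin n → ℝ)) = U)
    (hat : atlas (Fin n → ℝ) (OrbitSpace Γ U) = orbitAtlas Γ U)
    (hB : ∀ γ ∈ Γ, ∀ u v, B (γ.linear u) (γ.linear v) = B u v) (hg : g.val = fun _ => B)
    {x : Fin n → ℝ} {γ : (Fin n → ℝ) ≃ᵃ[ℝ] (Fin n → ℝ)} (hγ : γ ∈ Γ)
    (hseg : ∀ t : ℝ, x + t • (γ x - x) ∈ U) {D : (Fin n → ℝ) ≃ₗ[ℝ] (Fin n → ℝ)}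
    (hD : ∀ v : Fin n → ℝ,
      mfderiv 𝓘(ℝ, Fin n → ℝ) 𝓘(ℝ, Fin n → ℝ) (orbitProjExt Γ U) x v = D v) :
    g.IsLoopTransport (orbitProjExt Γ U x) (D.symm ≪≫ₗ γ.linear.symm ≪≫ₗ D) := by
  have hx : x ∈ U := by simpa using hseg 0
  set l : ℝ → Fin n → ℝ := fun t => x + t • (γ x - x) with hl
  have hl0 : l 0 = x := by simp [hl]
  have hl1 : l 1 = γ x := by simp [hl]
  have hlc : ContDiff ℝ ∞ l := contDiff_const.add (contDiff_id.smul contDiff_const)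
  have hP := contMDiffOn_orbitProjExt h hat
  refine ⟨fun t => orbitProjExt Γ U (l t), hP.comp_contMDiff hlc.contMDiff hseg,
    congrArg _ hl0, (congrArg _ hl1).trans (orbitProjExt_apply h hγ hx), fun v => ?_⟩
  refine ⟨fun t => ⟨orbitProjExt Γ U (l t),
    mfderiv 𝓘(ℝ, Fin n → ℝ) 𝓘(ℝ, Fin n → ℝ) (orbitProjExt Γ U) (l t) (D.symm v)⟩,
    ⟨?_, ?_⟩, fun _ => rfl, ?_, ?_⟩
  -- The candidate parallel field is the tangent map of the projection applied to a constant vector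
  -- along the line, hence smooth.
  · have h1 := (hP.contMDiffOn_tangentMapWithin (m := ∞) (by simp)
      U.2.uniqueMDiffOn).comp_contMDiff (contMDiff_tangentBundle_curve hlc (D.symm v)) hseg
    convert h1 using 1
    funext t
    exact (tangentMapWithin_eq_tangentMap
      (p := (⟨l t, D.symm v⟩ : TangentBundle 𝓘(ℝ, Fin n → ℝ) (Fin n → ℝ)))
      (U.2.uniqueMDiffOn _ (hseg t)) (mdifferentiableAt_orbitProjExt h hat (hseg t))).symm
  · intro e he t hte k
    obtain ⟨δ, hδ, hev⟩ := exists_mfderiv_chart h hat he (hseg t) hte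
    have h1 : (fun s => vectorComponents e (⟨orbitProjExt Γ U (l s),
        mfderiv 𝓘(ℝ, Fin n → ℝ) 𝓘(ℝ, Fin n → ℝ) (orbitProjExt Γ U) (l s) (D.symm v)⟩ :
        TangentBundle 𝓘(ℝ, Fin n → ℝ) (OrbitSpace Γ U)) k) =ᶠ[𝓝 t]
        fun _ => δ.linear (D.symm v) k := by
      filter_upwards [hlc.continuous.continuousAt.eventually hev] with s hs
      exact congrFun (hs (D.symm v)) k
    have h2 : ∀ i j, g.christoffel e k i j (e (orbitProjExt Γ U (l t))) = 0 := fun i j =>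
      christoffel_orbitSpace h hat hB hg he (e.map_source hte) k i j
    simp only [h2, h1.deriv_eq]
    simp
  · have h1 : ∀ (y : Fin n → ℝ), y = x → (⟨orbitProjExt Γ U y,
        mfderiv 𝓘(ℝ, Fin n → ℝ) 𝓘(ℝ, Fin n → ℝ) (orbitProjExt Γ U) y (D.symm v)⟩ :
        TangentBundle 𝓘(ℝ, Fin n → ℝ) (OrbitSpace Γ U)) = ⟨orbitProjExt Γ U x, v⟩ := by
      rintro y rfl
      exact congrArg (Bundle.TotalSpace.mk' (Fin n → ℝ) _)
        ((hD (D.symm v)).trans (D.apply_symm_apply v))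
    exact h1 _ hl0
  · have hγx : γ x ∈ U := mem_of_image_eq h hγ hx
    have hev : orbitProjExt Γ U ∘ γ =ᶠ[𝓝 x] orbitProjExt Γ U := by
      filter_upwards [U.2.mem_nhds hx] with z hz using orbitProjExt_apply h hγ hz
    have hfd : HasMFDerivAt 𝓘(ℝ, Fin n → ℝ) 𝓘(ℝ, Fin n → ℝ) γ x _ :=
      (γ.hasFDerivAt_of_finiteDimensional x).hasMFDerivAt
    have h2 := mfderiv_comp x (mdifferentiableAt_orbitProjExt h hat hγx) hfd.mdifferentiableAt
    have h3 : ∀ w : Fin n → ℝ, (mfderiv 𝓘(ℝ, Fin n → ℝ) 𝓘(ℝ, Fin n → ℝ)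
        (orbitProjExt Γ U) (γ x) (γ.linear w) : Fin n → ℝ) = D w := by
      intro w
      rw [← hD w]
      have h4 := congrArg (fun T : (Fin n → ℝ) →L[ℝ] (Fin n → ℝ) => T w)
        (h2.symm.trans hev.mfderiv_eq)
      refine Eq.trans ?_ h4
      exact congrArg (fun T : (Fin n → ℝ) →L[ℝ] (Fin n → ℝ) =>
        (mfderiv 𝓘(ℝ, Fin n → ℝ) 𝓘(ℝ, Fin n → ℝ) (orbitProjExt Γ U) (γ x) (T w) : Fin n → ℝ))
        hfd.mfderiv.symm
    have h5 := h3 (γ.linear.symm (D.symm v))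
    rw [LinearEquiv.apply_symm_apply] at h5
    -- Base points are generalized to variables so that the equality in the tangent bundle can be
    -- proved by substitution.
    have h6 : ∀ (y : Fin n → ℝ) (p : OrbitSpace Γ U) (w : Fin n → ℝ), y = γ x →
        orbitProjExt Γ U (γ x) = p → (mfderiv 𝓘(ℝ, Fin n → ℝ) 𝓘(ℝ, Fin n → ℝ)
          (orbitProjExt Γ U) (γ x) (D.symm v) : Fin n → ℝ) = w → (⟨orbitProjExt Γ U y,
        mfderiv 𝓘(ℝ, Fin n → ℝ) 𝓘(ℝ, Fin n → ℝ) (orbitProjExt Γ U) y (D.symm v)⟩ :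
        TangentBundle 𝓘(ℝ, Fin n → ℝ) (OrbitSpace Γ U)) = ⟨p, w⟩ := by
      rintro y p w rfl rfl rfl
      rfl
    exact h6 _ _ _ hl1 (orbitProjExt_apply h hγ hx) h5

/-- The holonomy group contains the inverses of all linear parts, conjugated by one fixed `D`;
inversion and conjugation preserve the failure to commute. -/
theorem exists_not_commute_holonomyGroup (h : ∀ γ ∈ Γ, γ '' (U : Set (Fin n → ℝ)) = U)
    (hat : atlas (Fin n → ℝ) (OrbitSpace Γ U) = orbitAtlas Γ U)
    (hB : ∀ γ ∈ Γ, ∀ u v, B (γ.linear u) (γ.linear v) = B u v) (hg : g.val = fun _ => B)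
    (hseg : ∀ γ ∈ Γ, ∀ x ∈ U, ∀ t : ℝ, x + t • (γ x - x) ∈ U)
    (hΓ : ∃ α ∈ linearParts Γ, ∃ β ∈ linearParts Γ, α * β ≠ β * α) (p : OrbitSpace Γ U) :
    ∃ α ∈ g.holonomyGroup p, ∃ β ∈ g.holonomyGroup p, α * β ≠ β * α := by
  obtain ⟨x, hx, rfl⟩ := exists_orbitProjExt_eq p
  obtain ⟨D, -, hD⟩ := exists_mfderiv_orbitProjExt_equiv h hat hB hx
  obtain ⟨_, ⟨α, hα, rfl⟩, _, ⟨β, hβ, rfl⟩, hne⟩ := hΓ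
  refine ⟨_, Subgroup.subset_closure
    (isLoopTransport_orbitSpace h hat hB hg hα (hseg α hα x hx) hD), _, Subgroup.subset_closure
    (isLoopTransport_orbitSpace h hat hB hg hβ (hseg β hβ x hx) hD), fun hcomm => hne ?_⟩
  have h1 : ∀ w : Fin n → ℝ, α.linear.symm (β.linear.symm w) = β.linear.symm (α.linear.symm w) := by
    intro w
    have h2 := LinearEquiv.congr_fun hcomm (D w)
    have h3 : D (α.linear.symm (D.symm (D (β.linear.symm (D.symm (D w)))))) =
      D (β.linear.symm (D.symm (D (α.linear.symm (D.symm (D w)))))) := h2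
    simpa using h3
  ext1 w
  change α.linear (β.linear w) = β.linear (α.linear w)
  have h4 := h1 (β.linear (α.linear w))
  simp only [LinearEquiv.symm_apply_apply] at h4
  simpa using congrArg (fun z => α.linear (β.linear z)) h4

end OrbitGlobal

/-! ### The affine Heisenberg group and its action on the regular set. -/

section Heisenberg

open Topology Filter Set PseudoRiemannianMetric

theorem form44_eq (x y : Fin 8 → ℝ) : form44 x y = x 0 * y 6 + x 1 * y 7 + x 2 * y 2 + x 3 * y 3
    - x 4 * y 4 - x 5 * y 5 + x 6 * y 0 + x 7 * y 1 := by
  simp [form44, Q44, Matrix.mulVec, dotProduct, Fin.sum_univ_eight]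
  ring

/-- The linear map `I + a A₁ + b A₂ + m A₁ A₂`. -/
def heisFun (a b m : ℝ) (x : Fin 8 → ℝ) : Fin 8 → ℝ :=
  ![x 0 + a * (x 2 - x 5) - b * (x 3 + x 4) - 2 * m * x 7,
    x 1 + a * (x 3 - x 4) + b * (x 2 + x 5) + 2 * m * x 6,
    x 2 - a * x 6 - b * x 7, x 3 - a * x 7 + b * x 6, x 4 - a * x 7 - b * x 6,
    x 5 - a * x 6 + b * x 7, x 6, x 7]

/-- A₁ and A₂ square to zero and anticommute, and triple products vanish, so the cross terms add up
to (ab' - ba')A₁A₂. -/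
theorem heisFun_heisFun (a b m a' b' m' : ℝ) (x : Fin 8 → ℝ) :
    heisFun a b m (heisFun a' b' m' x) =
      heisFun (a + a') (b + b') (m + m' + a * b' - b * a') x := by
  ext i
  fin_cases i <;> simp [heisFun] <;> ring

theorem heisFun_zero (x : Fin 8 → ℝ) : heisFun 0 0 0 x = x := by
  ext i
  fin_cases i <;> simp [heisFun]

/-- `heisFun` as a linear automorphism. -/
def heisEquiv (a b m : ℝ) : (Fin 8 → ℝ) ≃ₗ[ℝ] (Fin 8 → ℝ) where
  toFun := heisFun a b m
  invFun := heisFun (-a) (-b) (-m)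
  map_add' x y := by
    ext i
    fin_cases i <;> simp [heisFun] <;> ring
  map_smul' r x := by
    ext i
    fin_cases i <;> simp [heisFun] <;> ring
  left_inv x := by
    rw [heisFun_heisFun]
    convert heisFun_zero x using 2 <;> ring
  right_inv x := by
    rw [heisFun_heisFun]
    convert heisFun_zero x using 2 <;> ring

/-- The common fixed point of the affine Heisenberg group. -/
def heisCenter : Fin 8 → ℝ := ![0, 0, 0, 0, 0, 0, 1, 0]

/-- The affine transformation with linear part `L` that maps `heisCenter` to `heisCenter + w`. -/
def affineAt (L : (Fin 8 → ℝ) ≃ₗ[ℝ] (Fin 8 → ℝ)) (w : Fin 8 → ℝ) :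
    (Fin 8 → ℝ) ≃ᵃ[ℝ] (Fin 8 → ℝ) :=
  L.toAffineEquiv.trans (AffineEquiv.constVAdd ℝ _ (w + heisCenter - L heisCenter))

theorem affineAt_apply (L : (Fin 8 → ℝ) ≃ₗ[ℝ] (Fin 8 → ℝ)) (w x : Fin 8 → ℝ) :
    affineAt L w x = L (x - heisCenter) + heisCenter + w := by
  simp only [affineAt, AffineEquiv.trans_apply, LinearEquiv.coe_toAffineEquiv,
    AffineEquiv.constVAdd_apply, vadd_eq_add, map_sub]
  abel

theorem affineAt_linear (L : (Fin 8 → ℝ) ≃ₗ[ℝ] (Fin 8 → ℝ)) (w : Fin 8 → ℝ) :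
    (affineAt L w).linear = L := by
  ext1 x
  rfl

/-- The element of the affine Heisenberg group with real parameters `a`, `b`, `m`. -/
def heisAffine (a b m : ℝ) : (Fin 8 → ℝ) ≃ᵃ[ℝ] (Fin 8 → ℝ) := affineAt (heisEquiv a b m) 0

theorem heisAffine_apply (a b m : ℝ) (x : Fin 8 → ℝ) : heisAffine a b m x =
    ![x 0 + a * (x 2 - x 5) - b * (x 3 + x 4) - 2 * m * x 7,
      x 1 + a * (x 3 - x 4) + b * (x 2 + x 5) + 2 * m * (x 6 - 1),
      x 2 - a * (x 6 - 1) - b * x 7, x 3 - a * x 7 + b * (x 6 - 1),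
      x 4 - a * x 7 - b * (x 6 - 1), x 5 - a * (x 6 - 1) + b * x 7, x 6, x 7] := by
  rw [heisAffine, affineAt_apply]
  change heisFun a b m _ + _ + _ = _
  ext i
  fin_cases i <;> simp [heisFun, heisCenter]

theorem heisAffine_mul (a b m a' b' m' : ℝ) : heisAffine a b m * heisAffine a' b' m' =
    heisAffine (a + a') (b + b') (m + m' + a * b' - b * a') := by
  ext1 x
  change heisAffine a b m (heisAffine a' b' m' x) = _
  simp only [heisAffine, affineAt_apply, add_zero, add_sub_cancel_right]
  exact congrArg (· + _) (heisFun_heisFun _ _ _ _ _ _ _)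

/-- The affine representation of the discrete Heisenberg group. -/
def heisHom : DiscreteHeisenberg →* ((Fin 8 → ℝ) ≃ᵃ[ℝ] (Fin 8 → ℝ)) where
  -- The matrix group has cocycle ab', the affine one ab' - ba'. The latter is 2ab' minus the
  -- coboundary of ab, hence m = 2c - ab.
  toFun h := heisAffine h.a h.b (2 * h.c - h.a * h.b)
  map_one' := by
    ext1 x
    simp only [DiscreteHeisenberg.one_def, heisAffine_apply]
    ext i
    fin_cases i <;> simp
  map_mul' h k := by
    rw [heisAffine_mul, DiscreteHeisenberg.mul_def]
    push_cast
    congr 1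
    ring

theorem heisHom_apply (h : DiscreteHeisenberg) :
    heisHom h = heisAffine h.a h.b (2 * h.c - h.a * h.b) := rfl

theorem heisHom_X : heisHom ⟨1, 0, 0⟩ = gamma₁ := by
  ext1 x
  rw [heisHom_apply, heisAffine_apply]
  change _ = (1 + A₁) *ᵥ x + _
  rw [Matrix.add_mulVec, Matrix.one_mulVec]
  ext i
  simp only [Pi.add_apply, Matrix.mulVec, dotProduct, Fin.sum_univ_eight]
  fin_cases i <;> simp [A₁] <;> ring

theorem heisHom_Y : heisHom ⟨0, 1, 0⟩ = gamma₂ := by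
  ext1 x
  rw [heisHom_apply, heisAffine_apply]
  change _ = (1 + A₂) *ᵥ x + _
  rw [Matrix.add_mulVec, Matrix.one_mulVec]
  ext i
  simp only [Pi.add_apply, Matrix.mulVec, dotProduct, Fin.sum_univ_eight]
  fin_cases i <;> simp [A₂] <;> ring

theorem heis_zpow_X (k : ℤ) : (⟨1, 0, 0⟩ : DiscreteHeisenberg) ^ k = ⟨k, 0, 0⟩ := by
  induction k with
  | zero => rfl
  | succ k ih => rw [zpow_add_one, ih, DiscreteHeisenberg.mul_def]; simp
  | pred k ih =>
    rw [zpow_sub_one, ih, DiscreteHeisenberg.mul_def, DiscreteHeisenberg.inv_def]; simp; ring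

theorem heis_zpow_Y (k : ℤ) : (⟨0, 1, 0⟩ : DiscreteHeisenberg) ^ k = ⟨0, k, 0⟩ := by
  induction k with
  | zero => rfl
  | succ k ih => rw [zpow_add_one, ih, DiscreteHeisenberg.mul_def]; simp
  | pred k ih =>
    rw [zpow_sub_one, ih, DiscreteHeisenberg.mul_def, DiscreteHeisenberg.inv_def]; simp; ring

theorem heis_zpow_Z (k : ℤ) : (⟨0, 0, 1⟩ : DiscreteHeisenberg) ^ k = ⟨0, 0, k⟩ := by
  induction k with
  | zero => rfl
  | succ k ih => rw [zpow_add_one, ih, DiscreteHeisenberg.mul_def]; simp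
  | pred k ih =>
    rw [zpow_sub_one, ih, DiscreteHeisenberg.mul_def, DiscreteHeisenberg.inv_def]; simp; ring

theorem heis_closure :
    Subgroup.closure {(⟨1, 0, 0⟩ : DiscreteHeisenberg), ⟨0, 1, 0⟩} = ⊤ := by
  refine (Subgroup.eq_top_iff' _).2 fun h => ?_
  set S := Subgroup.closure {(⟨1, 0, 0⟩ : DiscreteHeisenberg), ⟨0, 1, 0⟩}
  have hX : (⟨1, 0, 0⟩ : DiscreteHeisenberg) ∈ S := Subgroup.subset_closure (by simp)
  have hY : (⟨0, 1, 0⟩ : DiscreteHeisenberg) ∈ S := Subgroup.subset_closure (by simp)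
  have hZ : (⟨0, 0, 1⟩ : DiscreteHeisenberg) ∈ S := by
    -- The commutator of the two generators is the central generator.
    have h1 := S.mul_mem (S.mul_mem hX hY) (S.mul_mem (S.inv_mem hX) (S.inv_mem hY))
    exact h1
  -- In the order Y, X, Z no cross term ab arises.
  have h1 := S.mul_mem (S.mul_mem (S.zpow_mem hY h.b) (S.zpow_mem hX h.a)) (S.zpow_mem hZ h.c)
  rw [heis_zpow_X, heis_zpow_Y, heis_zpow_Z] at h1
  simpa [DiscreteHeisenberg.mul_def] using h1

theorem range_heisHom : heisHom.range = Gamma44 := by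
  rw [MonoidHom.range_eq_map, ← heis_closure, MonoidHom.map_closure, Gamma44]
  congr 1
  rw [image_pair, heisHom_X, heisHom_Y]

/-- The open set `{x | (x₆, x₇) ≠ (1, 0)}`. -/
def regularSet : Set (Fin 8 → ℝ) := {x | x 6 - 1 ≠ 0 ∨ x 7 ≠ 0}

theorem isOpen_regularSet : IsOpen regularSet := by
  refine IsOpen.union ?_ ?_
  · exact isOpen_ne_fun (by fun_prop) continuous_const
  · exact isOpen_ne_fun (by fun_prop) continuous_const

theorem isConnected_regularSet : IsConnected regularSet := by
  have h1 : IsConnected ({(0 : ℝ × ℝ)}ᶜ : Set (ℝ × ℝ)) :=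
    isConnected_compl_singleton_of_one_lt_rank (by simp [one_add_one_eq_two]) 0
  have h2 := h1.prod (isConnected_univ (α := Fin 8 → ℝ))
  -- The last two coordinates of the ℝ⁸ factor are overwritten by the shifted point of the punctured
  -- plane.
  have h3 := h2.image (fun q => ![q.2 0, q.2 1, q.2 2, q.2 3, q.2 4, q.2 5, q.1.1 + 1, q.1.2])
    (Continuous.continuousOn (by
      refine continuous_pi fun i => ?_
      fin_cases i <;> simp <;> fun_prop))
  convert h3
  ext x
  constructor
  · intro hx
    refine ⟨((x 6 - 1, x 7), x), ⟨?_, mem_univ _⟩, ?_⟩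
    · intro h0
      have h0' := Prod.ext_iff.1 (mem_singleton_iff.1 h0)
      rcases hx with hx | hx
      · exact hx h0'.1
      · exact hx h0'.2
    · ext i
      fin_cases i <;> simp
  · rintro ⟨⟨⟨s, t⟩, y⟩, ⟨hz, -⟩, rfl⟩
    by_contra hcon
    simp only [regularSet, mem_ofPred_eq, not_or, not_not] at hcon
    apply hz
    have h1 : s = 0 := by simpa using hcon.1
    have h2 : t = 0 := by simpa using hcon.2
    simp [h1, h2]

/-- The squared norm of the vector `(x₆ - 1, x₇)`. -/
def zetaSq (x : Fin 8 → ℝ) : ℝ := (x 6 - 1) ^ 2 + x 7 ^ 2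

theorem zetaSq_pos {x : Fin 8 → ℝ} (hx : x ∈ regularSet) : 0 < zetaSq x := by
  rcases hx with hx | hx
  · have := sq_nonneg (x 7)
    have : 0 < (x 6 - 1) ^ 2 := by positivity
    unfold zetaSq; linarith
  · have := sq_nonneg (x 6 - 1)
    have : 0 < (x 7) ^ 2 := by positivity
    unfold zetaSq; linarith

/-- The first Heisenberg coordinate on the regular set. -/
noncomputable def heisCoordA (x : Fin 8 → ℝ) : ℝ :=
  -((x 2 + x 5) * (x 6 - 1) + (x 3 + x 4) * x 7) / (2 * zetaSq x)

/-- The second Heisenberg coordinate on the regular set. -/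
noncomputable def heisCoordB (x : Fin 8 → ℝ) : ℝ :=
  ((x 3 - x 4) * (x 6 - 1) + (x 5 - x 2) * x 7) / (2 * zetaSq x)

/-- The central Heisenberg coordinate on the regular set. -/
noncomputable def heisCoordC (x : Fin 8 → ℝ) : ℝ :=
  (x 1 * (x 6 - 1) - x 0 * x 7) / zetaSq x

theorem zetaSq_heisAffine (a b m : ℝ) (x : Fin 8 → ℝ) :
    zetaSq (heisAffine a b m x) = zetaSq x := by
  simp [heisAffine_apply, zetaSq]

/-- In the notation above, A = -⟨u, ζ⟩ / 2|ζ|², B = ⟨v, ζ⟩ / 2|ζ|², C = ⟨w, ζ⟩ / |ζ|², and ζ is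
invariant; the shift of u by -2aζ moves A by a. -/
theorem heisCoordA_heisAffine (a b m : ℝ) {x : Fin 8 → ℝ} (hx : x ∈ regularSet) :
    heisCoordA (heisAffine a b m x) = heisCoordA x + a := by
  have h := (zetaSq_pos hx).ne'
  rw [heisCoordA, zetaSq_heisAffine, heisCoordA, div_add' _ _ _ (by simpa using h)]
  congr 1
  simp [heisAffine_apply, zetaSq]
  ring

theorem heisCoordB_heisAffine (a b m : ℝ) {x : Fin 8 → ℝ} (hx : x ∈ regularSet) :
    heisCoordB (heisAffine a b m x) = heisCoordB x + b := by
  have h := (zetaSq_pos hx).ne'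
  rw [heisCoordB, zetaSq_heisAffine, heisCoordB, div_add' _ _ _ (by simpa using h)]
  congr 1
  simp [heisAffine_apply, zetaSq]
  ring

theorem heisCoordC_heisAffine (a b m : ℝ) {x : Fin 8 → ℝ} (hx : x ∈ regularSet) :
    heisCoordC (heisAffine a b m x) =
      heisCoordC x + 2 * m + 2 * a * heisCoordB x - 2 * b * heisCoordA x := by
  have h := (zetaSq_pos hx).ne'
  rw [heisCoordC, zetaSq_heisAffine, heisCoordC, heisCoordB, heisCoordA]
  field_simp
  simp [heisAffine_apply, zetaSq]
  ring

theorem continuous_zetaSq : Continuous zetaSq := by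
  unfold zetaSq
  fun_prop

theorem continuousOn_heisCoordA : ContinuousOn heisCoordA regularSet := by
  refine ContinuousOn.div (by fun_prop) (by have := continuous_zetaSq; fun_prop) fun x hx => ?_
  have := zetaSq_pos hx
  positivity

theorem continuousOn_heisCoordB : ContinuousOn heisCoordB regularSet := by
  refine ContinuousOn.div (by fun_prop) (by have := continuous_zetaSq; fun_prop) fun x hx => ?_
  have := zetaSq_pos hx
  positivity

theorem continuousOn_heisCoordC : ContinuousOn heisCoordC regularSet := by
  refine ContinuousOn.div (by fun_prop) (by have := continuous_zetaSq; fun_prop) fun x hx => ?_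
  exact (zetaSq_pos hx).ne'

theorem heisAffine_mem_regularSet {a b m : ℝ} {x : Fin 8 → ℝ} (hx : x ∈ regularSet) :
    heisAffine a b m x ∈ regularSet := by
  simpa [regularSet, heisAffine_apply] using hx

theorem Gamma44_image_regularSet : ∀ γ ∈ Gamma44, γ '' regularSet = regularSet := by
  have h : ∀ γ ∈ Gamma44, γ '' regularSet ⊆ regularSet := by
    rw [← range_heisHom]
    rintro _ ⟨k, rfl⟩ _ ⟨x, hx, rfl⟩
    exact heisAffine_mem_regularSet hx
  intro γ hγ
  refine (h γ hγ).antisymm fun x hx => ?_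
  exact ⟨γ⁻¹ x, h _ (Gamma44.inv_mem hγ) ⟨x, hx, rfl⟩, γ.apply_symm_apply x⟩

theorem heisHom_eq_one_of_fixed {h : DiscreteHeisenberg} {x : Fin 8 → ℝ} (hx : x ∈ regularSet)
    (e : heisHom h x = x) : h = 1 := by
  rw [heisHom_apply] at e
  have h1 := heisCoordA_heisAffine h.a h.b (2 * h.c - h.a * h.b) hx
  have h2 := heisCoordB_heisAffine h.a h.b (2 * h.c - h.a * h.b) hx
  have h3 := heisCoordC_heisAffine h.a h.b (2 * h.c - h.a * h.b) hx
  rw [e] at h1 h2 h3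
  have ha : (h.a : ℝ) = 0 := by linarith
  have hb : (h.b : ℝ) = 0 := by linarith
  rw [ha, hb] at h3
  have hc : (h.c : ℝ) = 0 := by linarith
  ext
  · exact_mod_cast ha
  · exact_mod_cast hb
  · exact_mod_cast hc

theorem zero_mem_regularSet : (0 : Fin 8 → ℝ) ∈ regularSet := Or.inl (by norm_num)

theorem heisHom_injective : Function.Injective heisHom := by
  refine (injective_iff_map_eq_one _).2 fun h hh => ?_
  exact heisHom_eq_one_of_fixed zero_mem_regularSet (by rw [hh]; rfl)

theorem nonempty_Gamma44_mulEquiv : Nonempty (Gamma44 ≃* DiscreteHeisenberg) := by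
  rw [← range_heisHom]
  exact ⟨(MonoidHom.ofInjective heisHom_injective).symm⟩

theorem actsFreelyOn_regularSet : ActsFreelyOn Gamma44 regularSet := by
  refine ⟨Gamma44_image_regularSet, ?_⟩
  rw [← range_heisHom]
  rintro _ ⟨k, rfl⟩ x hx e
  rw [heisHom_eq_one_of_fixed hx e, map_one]

/-- A, B and C are bounded on K. If x and its image both lie in K, the translation formulas bound a
and b first, and then c, leaving finitely many integer triples. -/
theorem actsProperlyDiscontinuouslyOn_regularSet :
    ActsProperlyDiscontinuouslyOn Gamma44 regularSet := by
  refine ⟨Gamma44_image_regularSet, fun K hKU hK => ?_⟩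
  obtain ⟨C₁, h₁⟩ := hK.exists_bound_of_continuousOn (continuousOn_heisCoordA.mono hKU)
  obtain ⟨C₂, h₂⟩ := hK.exists_bound_of_continuousOn (continuousOn_heisCoordB.mono hKU)
  obtain ⟨C₃, h₃⟩ := hK.exists_bound_of_continuousOn (continuousOn_heisCoordC.mono hKU)
  -- The formula for C gives 4c = C(γx) - C(x) + 2ab - 2aB + 2bA, with |a| ≤ 2C₁ and |b| ≤ 2C₂; the
  -- bound on c is not sharp.
  obtain ⟨R, hR⟩ := exists_nat_ge
    (max (2 * C₁) (max (2 * C₂) (2 * C₃ + 12 * (C₁ * C₂))))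
  simp only [max_le_iff] at hR
  refine ((((finite_Icc (-R : ℤ) R).prod ((finite_Icc (-R : ℤ) R).prod
    (finite_Icc (-R : ℤ) R))).image fun q => heisHom ⟨q.1, q.2.1, q.2.2⟩)).subset ?_
  rintro γ ⟨hγ, _, ⟨x, hx, rfl⟩, hγx⟩
  rw [← range_heisHom] at hγ
  obtain ⟨h, rfl⟩ := hγ
  refine ⟨(h.a, h.b, h.c), ?_, rfl⟩
  have e1 := heisCoordA_heisAffine h.a h.b (2 * h.c - h.a * h.b) (hKU hx)
  have e2 := heisCoordB_heisAffine h.a h.b (2 * h.c - h.a * h.b) (hKU hx)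
  have e3 := heisCoordC_heisAffine h.a h.b (2 * h.c - h.a * h.b) (hKU hx)
  rw [← heisHom_apply] at e1 e2 e3
  have a1 := h₁ _ hx
  have a2 := h₂ _ hx
  have a3 := h₃ _ hx
  have b1 := h₁ _ hγx
  have b2 := h₂ _ hγx
  have b3 := h₃ _ hγx
  simp only [Real.norm_eq_abs] at a1 a2 a3 b1 b2 b3
  set A := heisCoordA x
  set B := heisCoordB x
  have ha : |(h.a : ℝ)| ≤ 2 * C₁ := by
    have : (h.a : ℝ) = heisCoordA (heisHom h x) - A := by linarith
    rw [this]
    exact (abs_sub _ _).trans (by linarith)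
  have hb : |(h.b : ℝ)| ≤ 2 * C₂ := by
    have : (h.b : ℝ) = heisCoordB (heisHom h x) - B := by linarith
    rw [this]
    exact (abs_sub _ _).trans (by linarith)
  have p1 : |(h.a : ℝ) * B| ≤ 2 * C₁ * C₂ := by
    rw [abs_mul]; exact mul_le_mul ha a2 (abs_nonneg _) ((abs_nonneg _).trans ha)
  have p2 : |(h.b : ℝ) * A| ≤ 2 * C₂ * C₁ := by
    rw [abs_mul]; exact mul_le_mul hb a1 (abs_nonneg _) ((abs_nonneg _).trans hb)
  have p3 : |(h.a : ℝ) * h.b| ≤ 2 * C₁ * (2 * C₂) := by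
    rw [abs_mul]; exact mul_le_mul ha hb (abs_nonneg _) ((abs_nonneg _).trans ha)
  have hc : |(h.c : ℝ)| ≤ 2 * C₃ + 12 * (C₁ * C₂) := by
    rw [abs_le] at *
    constructor <;> linarith
  have hfin : ∀ z : ℤ, |(z : ℝ)| ≤ R → z ∈ Icc (-R : ℤ) R := by
    intro z hz
    rw [abs_le] at hz
    exact ⟨by exact_mod_cast hz.1, by exact_mod_cast hz.2⟩
  exact ⟨hfin _ (ha.trans hR.1), hfin _ (hb.trans hR.2.1), hfin _ (hc.trans hR.2.2)⟩

theorem Gamma44_le_Iso44 : Gamma44 ≤ Iso44 := by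
  rw [← range_heisHom]
  rintro _ ⟨h, rfl⟩ x y
  rw [heisHom_apply, heisAffine, affineAt_linear]
  change form44 (heisFun _ _ _ x) (heisFun _ _ _ y) = _
  rw [form44_eq, form44_eq]
  simp [heisFun]
  ring

theorem exists_not_commute_linearParts :
    ∃ α ∈ linearParts Gamma44, ∃ β ∈ linearParts Gamma44, α * β ≠ β * α := by
  rw [← range_heisHom]
  refine ⟨_, ⟨_, ⟨⟨1, 0, 0⟩, rfl⟩, rfl⟩, _, ⟨_, ⟨⟨0, 1, 0⟩, rfl⟩, rfl⟩, fun hcomm => ?_⟩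
  -- A₁A₂ sends e₆ to 2e₁ and A₂A₁ sends it to -2e₁.
  have h1 := congrFun (LinearEquiv.congr_fun hcomm (Pi.single 6 1)) 1
  rw [heisHom_apply, heisHom_apply] at h1
  simp only [LinearEquiv.mul_apply, heisAffine, AffineEquiv.linearHom_apply, affineAt_linear] at h1
  change heisFun _ _ _ (heisFun _ _ _ _) 1 = heisFun _ _ _ (heisFun _ _ _ _) 1 at h1
  simp [heisFun] at h1
  norm_num at h1

end Heisenberg

/-! ### The centralizer, its open orbit, and the scalar product. -/

section Centralizer

open Topology Filter Set PseudoRiemannianMetric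

/-- With `heisCenter` as origin the group is linear, so it suffices that the linear part commutes
with it and that the displacement of the origin is a fixed vector. -/
theorem affineAt_mem_centralizer44 {L : (Fin 8 → ℝ) ≃ₗ[ℝ] (Fin 8 → ℝ)} {w : Fin 8 → ℝ}
    (hform : ∀ x y, form44 (L x) (L y) = form44 x y)
    (hcomm : ∀ a b m x, L (heisFun a b m x) = heisFun a b m (L x))
    (hw : ∀ a b m, heisFun a b m w = w) : affineAt L w ∈ centralizer44 Gamma44 := by
  refine ⟨fun x y => ?_, ?_⟩
  · rw [affineAt_linear]
    exact hform x y
  · refine Subgroup.mem_centralizer_iff.2 ?_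
    rw [← range_heisHom]
    have key : ∀ a b m x, heisAffine a b m (affineAt L w x) =
        affineAt L w (heisAffine a b m x) := by
      intro a b m x
      have hadd := (heisEquiv a b m).map_add (L (x - heisCenter)) w
      change heisFun a b m _ = heisFun a b m _ + heisFun a b m _ at hadd
      rw [hw] at hadd
      simp only [heisAffine, affineAt_apply, add_zero]
      change heisFun a b m _ + _ = L (heisFun a b m _ + _ - _) + _ + _
      rw [add_sub_cancel_right, hcomm, add_right_comm _ heisCenter w, add_sub_cancel_right, hadd]
      abel
    rintro _ ⟨h, rfl⟩
    ext1 x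
    exact key _ _ _ x

theorem translation_mem_centralizer44 (r s : ℝ) :
    affineAt (LinearEquiv.refl ℝ _) ![r, s, 0, 0, 0, 0, 0, 0] ∈ centralizer44 Gamma44 := by
  refine affineAt_mem_centralizer44 (fun _ _ => rfl) (fun _ _ _ _ => rfl) fun a b m => ?_
  ext i
  fin_cases i <;> simp [heisFun]

/-- A family of unipotent isometries commuting with the Heisenberg group. -/
noncomputable def shearFun (p₀ p₁ p₂ p₃ : ℝ) (x : Fin 8 → ℝ) : Fin 8 → ℝ :=
  ![x 0 - (p₀ * x 2 + p₁ * x 3 - p₂ * x 4 - p₃ * x 5)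
      - (p₀ ^ 2 + p₁ ^ 2 - p₂ ^ 2 - p₃ ^ 2) / 2 * x 6,
    x 1 - (p₁ * x 2 - p₀ * x 3 + p₃ * x 4 - p₂ * x 5)
      - (p₀ ^ 2 + p₁ ^ 2 - p₂ ^ 2 - p₃ ^ 2) / 2 * x 7,
    x 2 + p₀ * x 6 + p₁ * x 7, x 3 + p₁ * x 6 - p₀ * x 7,
    x 4 + p₂ * x 6 - p₃ * x 7, x 5 + p₃ * x 6 + p₂ * x 7, x 6, x 7]

/-- `shearFun` as a linear automorphism. -/
noncomputable def shearEquiv (p₀ p₁ p₂ p₃ : ℝ) : (Fin 8 → ℝ) ≃ₗ[ℝ] (Fin 8 → ℝ) where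
  toFun := shearFun p₀ p₁ p₂ p₃
  invFun := shearFun (-p₀) (-p₁) (-p₂) (-p₃)
  map_add' x y := by
    ext i
    fin_cases i <;> simp [shearFun] <;> ring
  map_smul' r x := by
    ext i
    fin_cases i <;> simp [shearFun] <;> ring
  left_inv x := by
    ext i
    fin_cases i <;> simp [shearFun] <;> ring
  right_inv x := by
    ext i
    fin_cases i <;> simp [shearFun] <;> ring

/-- The shear is the exponential of a matrix of the same block shape as A₁ and A₂, with a lower
block P chosen so that it commutes with both; PᵀĨP is scalar, which gives the quadratic term. -/
theorem shear_mem_centralizer44 (p₀ p₁ p₂ p₃ : ℝ) :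
    affineAt (shearEquiv p₀ p₁ p₂ p₃) 0 ∈ centralizer44 Gamma44 := by
  refine affineAt_mem_centralizer44 (fun x y => ?_) (fun a b m x => ?_) fun a b m => ?_
  · change form44 (shearFun _ _ _ _ _) (shearFun _ _ _ _ _) = _
    rw [form44_eq, form44_eq]
    simp [shearFun]
    ring
  · change shearFun _ _ _ _ _ = heisFun _ _ _ (shearFun _ _ _ _ _)
    ext i
    fin_cases i <;> simp [shearFun, heisFun] <;> ring
  · ext i
    fin_cases i <;> simp [heisFun]

/-- The action of a `2 × 2` matrix on `ℝ⁸` that extends its action on the last two coordinates and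
commutes with the Heisenberg group. -/
noncomputable def slFun (a b c d : ℝ) (x : Fin 8 → ℝ) : Fin 8 → ℝ :=
  ![d * x 0 - c * x 1, -b * x 0 + a * x 1,
    (a * (x 2 + x 5) + b * (x 3 + x 4) - c * (x 3 - x 4) - d * (x 5 - x 2)) / 2,
    (c * (x 2 + x 5) + d * (x 3 + x 4) + a * (x 3 - x 4) + b * (x 5 - x 2)) / 2,
    (c * (x 2 + x 5) + d * (x 3 + x 4) - a * (x 3 - x 4) - b * (x 5 - x 2)) / 2,
    (a * (x 2 + x 5) + b * (x 3 + x 4) + c * (x 3 - x 4) + d * (x 5 - x 2)) / 2,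
    a * x 6 + b * x 7, c * x 6 + d * x 7]

theorem slFun_slFun (a b c d a' b' c' d' : ℝ) (x : Fin 8 → ℝ) :
    slFun a b c d (slFun a' b' c' d' x) =
      slFun (a * a' + b * c') (a * b' + b * d') (c * a' + d * c') (c * b' + d * d') x := by
  ext i
  fin_cases i <;> simp [slFun] <;> ring

theorem slFun_one (x : Fin 8 → ℝ) : slFun 1 0 0 1 x = x := by
  ext i
  fin_cases i <;> simp [slFun] <;> ring

/-- `slFun` as a linear automorphism. -/
noncomputable def slEquiv {a b c d : ℝ} (h : a * d - b * c = 1) :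
    (Fin 8 → ℝ) ≃ₗ[ℝ] (Fin 8 → ℝ) where
  toFun := slFun a b c d
  invFun := slFun d (-b) (-c) a
  map_add' x y := by
    ext i
    fin_cases i <;> simp [slFun] <;> ring
  map_smul' r x := by
    ext i
    fin_cases i <;> simp [slFun] <;> ring
  left_inv x := by
    rw [slFun_slFun]
    convert slFun_one x using 2 <;> linarith
  right_inv x := by
    rw [slFun_slFun]
    convert slFun_one x using 2 <;> linarith

/-- The matrix acts on each of u, v, w and (x₆, x₇), while the Heisenberg group only mixes these
copies of ℝ². The scalar square is 2 det(w, (x₆, x₇)) - det(u, v), so determinant 1 makes the action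
isometric. -/
theorem sl_mem_centralizer44 {a b c d : ℝ} (h : a * d - b * c = 1) :
    affineAt (slEquiv h) 0 ∈ centralizer44 Gamma44 := by
  refine affineAt_mem_centralizer44 (fun x y => ?_) (fun a b m x => ?_) fun a b m => ?_
  · change form44 (slFun _ _ _ _ _) (slFun _ _ _ _ _) = _
    rw [form44_eq, form44_eq]
    simp [slFun]
    linear_combination (x 0 * y 6 + x 1 * y 7 + x 2 * y 2 + x 3 * y 3
      - x 4 * y 4 - x 5 * y 5 + x 6 * y 0 + x 7 * y 1) * h
  · change slFun _ _ _ _ _ = heisFun _ _ _ (slFun _ _ _ _ _)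
    ext i
    fin_cases i <;> simp [slFun, heisFun] <;> ring
  · ext i
    fin_cases i <;> simp [heisFun]

theorem exists_centralizer44_apply_zero {x : Fin 8 → ℝ} (hx : x ∈ regularSet) :
    ∃ f ∈ centralizer44 Gamma44, f 0 = x := by
  have hN := (zetaSq_pos hx).ne'
  obtain ⟨s, hs⟩ : ∃ s, s = x 6 - 1 := ⟨_, rfl⟩
  have hs' : x 6 = s + 1 := by linarith
  obtain ⟨N, hN'⟩ : ∃ N, N = s ^ 2 + x 7 ^ 2 := ⟨_, rfl⟩
  have hN0 : N ≠ 0 := by rwa [hN', hs]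
  -- Relative to `heisCenter` the origin has last coordinates (-1, 0); this matrix sends them to (s,
  -- x₇).
  have hdet : -s * (-s / N) - x 7 / N * -x 7 = 1 := by
    field_simp
    linarith
  set F := affineAt (slEquiv hdet) 0
  -- The parameters solve two 2 × 2 linear systems of determinant ±N, so that the shear produces x₂,
  -- …, x₅; a translation then corrects x₀ and x₁.
  set E := affineAt (shearEquiv ((s * x 2 - x 7 * x 3) / N) ((x 7 * x 2 + s * x 3) / N)
    ((s * x 4 + x 7 * x 5) / N) ((s * x 5 - x 7 * x 4) / N)) 0
  have hEF := (centralizer44 Gamma44).mul_mem (shear_mem_centralizer44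
    ((s * x 2 - x 7 * x 3) / N) ((x 7 * x 2 + s * x 3) / N)
    ((s * x 4 + x 7 * x 5) / N) ((s * x 5 - x 7 * x 4) / N)) (sl_mem_centralizer44 hdet)
  set y := E (F 0) with hy
  have hF : F 0 - heisCenter = ![0, 0, 0, 0, 0, 0, s, x 7] := by
    simp only [F, affineAt_apply, add_zero, add_sub_cancel_right]
    change slFun _ _ _ _ _ = _
    ext i
    fin_cases i <;> simp [slFun, heisCenter]
  have hyx : ∀ i, 2 ≤ i → y i = x i := by
    intro i hi
    simp only [hy, E]
    rw [affineAt_apply, hF]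
    change (shearFun _ _ _ _ _ + _ + _) i = _
    fin_cases i <;> simp at hi <;> simp [shearFun, heisCenter]
    · field_simp; rw [hN']; ring
    · field_simp; rw [hN']; ring
    · field_simp; rw [hN']; ring
    · field_simp; rw [hN']; ring
    · linarith
  refine ⟨_, (centralizer44 Gamma44).mul_mem
    (translation_mem_centralizer44 (x 0 - y 0) (x 1 - y 1)) hEF, ?_⟩
  change affineAt _ _ y = x
  rw [affineAt_apply, LinearEquiv.refl_apply, sub_add_cancel]
  ext i
  rw [Pi.add_apply]
  by_cases hi : 2 ≤ i
  · rw [hyx i hi]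
    fin_cases i <;> simp at hi ⊢
  · fin_cases i <;> simp at hi ⊢

theorem commute_of_mem_centralizer44 {f : (Fin 8 → ℝ) ≃ᵃ[ℝ] (Fin 8 → ℝ)}
    (hf : f ∈ centralizer44 Gamma44) {γ : (Fin 8 → ℝ) ≃ᵃ[ℝ] (Fin 8 → ℝ)} (hγ : γ ∈ Gamma44)
    (x : Fin 8 → ℝ) : f (γ x) = γ (f x) :=
  (congrArg (fun k : (Fin 8 → ℝ) ≃ᵃ[ℝ] (Fin 8 → ℝ) => k x)
    (Subgroup.mem_centralizer_iff.1 hf.2 γ hγ)).symm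

/-- The complement of the regular set is the fixed point set of the centre of the group. -/
theorem not_mem_regularSet_iff {x : Fin 8 → ℝ} : x ∉ regularSet ↔ heisHom ⟨0, 0, 1⟩ x = x := by
  constructor
  · intro hx
    simp only [regularSet, mem_ofPred_eq, not_or, not_not] at hx
    rw [heisHom_apply, heisAffine_apply, hx.1, hx.2]
    ext i
    fin_cases i <;> simp [hx.2]
  · intro h hx
    have := congrArg DiscreteHeisenberg.c (heisHom_eq_one_of_fixed hx h)
    simp [DiscreteHeisenberg.one_def] at this

/-- A bijection commuting with a map preserves its fixed point set and the complement of that set.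
-/
theorem centralizer44_mem_regularSet_iff {f : (Fin 8 → ℝ) ≃ᵃ[ℝ] (Fin 8 → ℝ)}
    (hf : f ∈ centralizer44 Gamma44) {x : Fin 8 → ℝ} : f x ∈ regularSet ↔ x ∈ regularSet := by
  rw [← not_iff_not, not_mem_regularSet_iff, not_mem_regularSet_iff,
    ← commute_of_mem_centralizer44 hf (by rw [← range_heisHom]; exact ⟨_, rfl⟩), f.injective.eq_iff]

theorem exists_centralizer44_apply_eq {x y : Fin 8 → ℝ} (hx : x ∈ regularSet)
    (hy : y ∈ regularSet) : ∃ f ∈ centralizer44 Gamma44, f x = y := by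
  obtain ⟨f, hf, rfl⟩ := exists_centralizer44_apply_zero hx
  obtain ⟨k, hk, rfl⟩ := exists_centralizer44_apply_zero hy
  refine ⟨k * f⁻¹, (centralizer44 Gamma44).mul_mem hk ((centralizer44 Gamma44).inv_mem hf), ?_⟩
  exact congrArg k (f.symm_apply_apply 0)

theorem affineOrbit_eq_regularSet {x : Fin 8 → ℝ} (hx : x ∈ regularSet) :
    affineOrbit (centralizer44 Gamma44) x = regularSet := by
  ext y
  constructor
  · rintro ⟨f, hf, rfl⟩
    exact (centralizer44_mem_regularSet_iff hf).2 hx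
  · intro hy
    exact exists_centralizer44_apply_eq hx hy

/-- The orbit of a point off the regular set stays in the affine subspace x₆ = 1, x₇ = 0, so a small
displacement along e₇ leaves it and it is not open. -/
theorem eq_regularSet_of_isOpen {U : Set (Fin 8 → ℝ)} (hU : IsOpen U)
    (h : ∃ x₀, U = affineOrbit (centralizer44 Gamma44) x₀) : U = regularSet := by
  obtain ⟨x₀, rfl⟩ := h
  refine affineOrbit_eq_regularSet ?_
  by_contra hx₀
  have hmem : x₀ ∈ affineOrbit (centralizer44 Gamma44) x₀ :=
    ⟨1, (centralizer44 Gamma44).one_mem, rfl⟩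
  have hcont : Continuous fun t : ℝ => x₀ + t • (Pi.single 7 1 : Fin 8 → ℝ) := by fun_prop
  have hnhds : ∀ᶠ t : ℝ in 𝓝 0,
      x₀ + t • (Pi.single 7 1 : Fin 8 → ℝ) ∈ affineOrbit (centralizer44 Gamma44) x₀ :=
    hcont.continuousAt.eventually (hU.mem_nhds (by simpa using hmem))
  obtain ⟨t, ⟨f, hf, hft⟩, ht⟩ :=
    ((hnhds.filter_mono nhdsWithin_le_nhds).and
      (self_mem_nhdsWithin : ({0}ᶜ : Set ℝ) ∈ 𝓝[≠] 0)).exists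
  have h1 : f x₀ ∉ regularSet := fun hc => hx₀ ((centralizer44_mem_regularSet_iff hf).1 hc)
  simp only [regularSet, mem_ofPred_eq, not_or, not_not] at h1 hx₀
  apply ht
  have h2 := h1.2
  rw [hft] at h2
  simpa [hx₀.2] using h2

/-- The scalar product of `ℝ^{4,4}` as a bilinear map. -/
noncomputable def bilin44 : (Fin 8 → ℝ) →ₗ[ℝ] (Fin 8 → ℝ) →ₗ[ℝ] ℝ := Matrix.toLinearMap₂' ℝ Q44

theorem bilin44_apply (x y : Fin 8 → ℝ) : bilin44 x y = form44 x y :=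
  Matrix.toLinearMap₂'_apply' _ _ _

theorem form44_nondegenerate {x : Fin 8 → ℝ} (h : ∀ y, form44 x y = 0) : x = 0 := by
  have h' := fun i => h (Pi.single i 1)
  simp only [form44_eq] at h'
  have h0 := h' 0
  have h1 := h' 1
  have h2 := h' 2
  have h3 := h' 3
  have h4 := h' 4
  have h5 := h' 5
  have h6 := h' 6
  have h7 := h' 7
  simp at h0 h1 h2 h3 h4 h5 h6 h7
  ext i
  fin_cases i <;> assumption

/-- An orthonormal family of `ℝ^{4,4}`. -/
noncomputable def orthoFamily44 : Fin 4 ⊕ Fin 4 → Fin 8 → ℝ :=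
  Sum.elim
    ![![1, 0, 0, 0, 0, 0, 1 / 2, 0], ![0, 1, 0, 0, 0, 0, 0, 1 / 2],
      ![0, 0, 1, 0, 0, 0, 0, 0], ![0, 0, 0, 1, 0, 0, 0, 0]]
    ![![1, 0, 0, 0, 0, 0, -1 / 2, 0], ![0, 1, 0, 0, 0, 0, 0, -1 / 2],
      ![0, 0, 0, 0, 1, 0, 0, 0], ![0, 0, 0, 0, 0, 1, 0, 0]]

theorem orthoFamily44_ortho (i j : Fin 4 ⊕ Fin 4) (h : i ≠ j) :
    form44 (orthoFamily44 i) (orthoFamily44 j) = 0 := by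
  rw [form44_eq]
  rcases i with i | i <;> rcases j with j | j <;> fin_cases i <;> fin_cases j <;>
    first
    | exact absurd rfl h
    | (simp [orthoFamily44]; done)
    | (simp [orthoFamily44]; norm_num)

theorem orthoFamily44_inl (i : Fin 4) :
    form44 (orthoFamily44 (Sum.inl i)) (orthoFamily44 (Sum.inl i)) = 1 := by
  rw [form44_eq]
  fin_cases i <;> simp [orthoFamily44] <;> norm_num

theorem orthoFamily44_inr (i : Fin 4) :
    form44 (orthoFamily44 (Sum.inr i)) (orthoFamily44 (Sum.inr i)) = -1 := by
  rw [form44_eq]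
  fin_cases i <;> simp [orthoFamily44]

theorem exists_orthonormal_basis44 : ∃ b : Module.Basis (Fin 4 ⊕ Fin 4) ℝ (Fin 8 → ℝ),
    ⇑b = orthoFamily44 := by
  have hli : LinearIndependent ℝ orthoFamily44 := by
    -- Orthogonal vectors of nonzero square are independent, and there are eight of them.
    refine LinearMap.linearIndependent_of_isOrthoᵢ (B := bilin44) ?_ ?_
    · intro i j hij
      exact (bilin44_apply _ _).trans (orthoFamily44_ortho i j hij)
    · intro i hi
      have hi' : form44 (orthoFamily44 i) (orthoFamily44 i) = 0 := (bilin44_apply _ _).symm.trans hi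
      rcases i with i | i
      · rw [orthoFamily44_inl] at hi'; norm_num at hi'
      · rw [orthoFamily44_inr] at hi'; norm_num at hi'
  exact ⟨basisOfLinearIndependentOfCardEqFinrank hli (by simp), by simp⟩

end Centralizer

/-! ### The pseudo-Riemannian quotient and the main theorem. -/

open Topology Filter Set PseudoRiemannianMetric in
theorem regularSet_quotient (U : TopologicalSpace.Opens (Fin 8 → ℝ))
    (hU : (U : Set (Fin 8 → ℝ)) = regularSet) :
    ∃ (_ : ChartedSpace (Fin 8 → ℝ) (OrbitSpace Gamma44 U))
      (_ : IsManifold 𝓘(ℝ, Fin 8 → ℝ) ∞ (OrbitSpace Gamma44 U))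
      (g : PseudoRiemannianMetric 8 (OrbitSpace Gamma44 U)),
      IsLocalDiffeomorph 𝓘(ℝ, Fin 8 → ℝ) 𝓘(ℝ, Fin 8 → ℝ) ∞ (orbitProj Gamma44 U) ∧
      (∀ (x : U) (u v : TangentSpace 𝓘(ℝ, Fin 8 → ℝ) x),
        g.val (orbitProj Gamma44 U x)
          (mfderiv 𝓘(ℝ, Fin 8 → ℝ) 𝓘(ℝ, Fin 8 → ℝ) (orbitProj Gamma44 U) x u)
          (mfderiv 𝓘(ℝ, Fin 8 → ℝ) 𝓘(ℝ, Fin 8 → ℝ) (orbitProj Gamma44 U) x v) =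
        form44
          (mfderiv 𝓘(ℝ, Fin 8 → ℝ) 𝓘(ℝ, Fin 8 → ℝ) (Subtype.val : U → (Fin 8 → ℝ)) x u)
          (mfderiv 𝓘(ℝ, Fin 8 → ℝ) 𝓘(ℝ, Fin 8 → ℝ) (Subtype.val : U → (Fin 8 → ℝ)) x v)) ∧
      g.HasSignature 4 4 ∧
      g.IsFlat ∧
      g.IsHomogeneous ∧
      ¬ g.IsComplete ∧
      ∀ p : OrbitSpace Gamma44 U,
        ∃ α ∈ g.holonomyGroup p, ∃ β ∈ g.holonomyGroup p, α * β ≠ β * α := by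
  have hmem : ∀ x, x ∈ U ↔ x ∈ regularSet := fun x => by rw [← hU]; rfl
  have hf : ActsFreelyOn Gamma44 (U : Set (Fin 8 → ℝ)) := hU ▸ actsFreelyOn_regularSet
  have hp : ActsProperlyDiscontinuouslyOn Gamma44 (U : Set (Fin 8 → ℝ)) :=
    hU ▸ actsProperlyDiscontinuouslyOn_regularSet
  have h0 : (0 : Fin 8 → ℝ) ∈ U := (hmem 0).2 zero_mem_regularSet
  have : Nonempty U := ⟨⟨0, h0⟩⟩
  have hloc := isLocalHomeomorph_orbitProj hf hp
  have hB : ∀ γ ∈ Gamma44, ∀ u v, bilin44 (γ.linear u) (γ.linear v) = bilin44 u v := by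
    intro γ hγ u v
    rw [bilin44_apply, bilin44_apply]
    exact Gamma44_le_Iso44 hγ u v
  let := orbitChartedSpace hloc
  have hman := isManifold_orbitSpace hf.1 hloc
  have hat : atlas (Fin 8 → ℝ) (OrbitSpace Gamma44 U) = orbitAtlas Gamma44 U := rfl
  have hcoord : ∀ γ ∈ Gamma44, ∀ x, γ x 6 = x 6 ∧ γ x 7 = x 7 := by
    rw [← range_heisHom]
    rintro _ ⟨h, rfl⟩ x
    rw [heisHom_apply, heisAffine_apply]
    simp
  let g := orbitMetric hf.1 hat hB
    (fun u v => by simp only [bilin44_apply, form44_eq]; ring)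
    (fun u hu => form44_nondegenerate fun v => by rw [← bilin44_apply, hu])
  have hg : g.val = fun _ => bilin44 := rfl
  refine ⟨inferInstance, hman, g, isLocalDiffeomorph_orbitProj hf.1 hloc hat, ?_, ?_,
    isFlat_orbitSpace hf.1 hat hB hg, isHomogeneous_orbitSpace hf.1 hat hB hg ?_, ?_,
    exists_not_commute_holonomyGroup hf.1 hat hB hg ?_ exists_not_commute_linearParts⟩
  · intro x u v
    obtain ⟨γ, hγ, hd⟩ := mfderiv_orbitProj hf.1 hat x
    refine (congrArg₂ (fun u v => bilin44 u v) (hd u) (hd v)).trans ?_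
    exact (hB γ hγ _ _).trans (bilin44_apply _ _)
  · intro x
    obtain ⟨b, hb⟩ := exists_orthonormal_basis44
    have hbil : ∀ i j, g.val x (b i) (b j) = form44 (orthoFamily44 i) (orthoFamily44 j) :=
      fun i j => by rw [← hb]; exact bilin44_apply _ _
    exact ⟨b, fun i j hij => (hbil i j).trans (orthoFamily44_ortho i j hij),
      fun i => (hbil _ _).trans (orthoFamily44_inl i),
      fun i => (hbil _ _).trans (orthoFamily44_inr i)⟩
  · intro x hx y hy
    obtain ⟨f, hfG, rfl⟩ := exists_centralizer44_apply_eq ((hmem x).1 hx) ((hmem y).1 hy)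
    refine ⟨f, rfl, fun γ hγ x => commute_of_mem_centralizer44 hfG hγ x, ?_, fun u v => ?_⟩
    · rw [hU]
      ext z
      constructor
      · rintro ⟨w, hw, rfl⟩
        exact (centralizer44_mem_regularSet_iff hfG).2 hw
      · intro hz
        refine ⟨f.symm z, ?_, f.apply_symm_apply z⟩
        rwa [← centralizer44_mem_regularSet_iff hfG, f.apply_symm_apply]
    · rw [bilin44_apply, bilin44_apply]
      exact hfG.1 u v
  · intro hc
    obtain ⟨c, hc, hv⟩ := hc ⟨orbitProjExt Gamma44 U 0, mfderiv 𝓘(ℝ, Fin 8 → ℝ)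
      𝓘(ℝ, Fin 8 → ℝ) (orbitProjExt Gamma44 U) 0 (Pi.single 6 1 : Fin 8 → ℝ)⟩
    -- At time 1 the geodesic from 0 with velocity e₆ would have (x₆, x₇) = (1, 0), outside U.
    obtain ⟨x, hx, hxk⟩ := exists_coord_of_isGeodesic hf.1 hat hB hg hc h0 hv 1
    have h6 := hxk 6 fun γ hγ x => (hcoord γ hγ x).1
    have h7 := hxk 7 fun γ hγ x => (hcoord γ hγ x).2
    simp at h6 h7
    rcases (hmem x).1 hx with h | h
    · exact h (by rw [h6, sub_self])
    · exact h h7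
  -- x₆ and x₇ are constant along the line through x and γx.
  · intro γ hγ x hx t
    rw [hmem] at hx ⊢
    simpa [regularSet, (hcoord γ hγ x).1, (hcoord γ hγ x).2] using hx

theorem mainTheorem3 :
    Gamma44 ≤ Iso44 ∧
    Nonempty (Gamma44 ≃* DiscreteHeisenberg) ∧
    IsOpen (affineOrbit (centralizer44 Gamma44) 0) ∧
    ∀ U : TopologicalSpace.Opens (Fin 8 → ℝ),
      (∃ x₀, (U : Set (Fin 8 → ℝ)) = affineOrbit (centralizer44 Gamma44) x₀) →
      ActsFreelyOn Gamma44 (U : Set (Fin 8 → ℝ)) ∧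
      ActsProperlyDiscontinuouslyOn Gamma44 (U : Set (Fin 8 → ℝ)) ∧
      (∃ α ∈ linearParts Gamma44, ∃ β ∈ linearParts Gamma44, α * β ≠ β * α) ∧
      T2Space (OrbitSpace Gamma44 U) ∧
      SecondCountableTopology (OrbitSpace Gamma44 U) ∧
      ConnectedSpace (OrbitSpace Gamma44 U) ∧
      ∃ (_ : ChartedSpace (Fin 8 → ℝ) (OrbitSpace Gamma44 U))
        (_ : IsManifold 𝓘(ℝ, Fin 8 → ℝ) ∞ (OrbitSpace Gamma44 U))
        (g : PseudoRiemannianMetric 8 (OrbitSpace Gamma44 U)),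
        IsLocalDiffeomorph 𝓘(ℝ, Fin 8 → ℝ) 𝓘(ℝ, Fin 8 → ℝ) ∞ (orbitProj Gamma44 U) ∧
        (∀ (x : U) (u v : TangentSpace 𝓘(ℝ, Fin 8 → ℝ) x),
          g.val (orbitProj Gamma44 U x)
            (mfderiv 𝓘(ℝ, Fin 8 → ℝ) 𝓘(ℝ, Fin 8 → ℝ) (orbitProj Gamma44 U) x u)
            (mfderiv 𝓘(ℝ, Fin 8 → ℝ) 𝓘(ℝ, Fin 8 → ℝ) (orbitProj Gamma44 U) x v) =
          form44
            (mfderiv 𝓘(ℝ, Fin 8 → ℝ) 𝓘(ℝ, Fin 8 → ℝ) (Subtype.val : U → (Fin 8 → ℝ)) x u)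
            (mfderiv 𝓘(ℝ, Fin 8 → ℝ) 𝓘(ℝ, Fin 8 → ℝ) (Subtype.val : U → (Fin 8 → ℝ)) x v)) ∧
        g.HasSignature 4 4 ∧
        g.IsFlat ∧
        g.IsHomogeneous ∧
        ¬ g.IsComplete ∧
        ∀ p : OrbitSpace Gamma44 U,
          ∃ α ∈ g.holonomyGroup p, ∃ β ∈ g.holonomyGroup p, α * β ≠ β * α := by
  refine ⟨Gamma44_le_Iso44, nonempty_Gamma44_mulEquiv, ?_, fun U hU => ?_⟩
  · rw [affineOrbit_eq_regularSet zero_mem_regularSet]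
    exact isOpen_regularSet
  · have hU : (U : Set (Fin 8 → ℝ)) = regularSet := eq_regularSet_of_isOpen U.2 hU
    have hf : ActsFreelyOn Gamma44 (U : Set (Fin 8 → ℝ)) := hU ▸ actsFreelyOn_regularSet
    have hp : ActsProperlyDiscontinuouslyOn Gamma44 (U : Set (Fin 8 → ℝ)) :=
      hU ▸ actsProperlyDiscontinuouslyOn_regularSet
    exact ⟨hf, hp, exists_not_commute_linearParts, t2Space_orbitSpace hp,
      secondCountableTopology_orbitSpace hp.1,
      connectedSpace_orbitSpace (hU ▸ isConnected_regularSet), regularSet_quotient U hU⟩
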